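/- Let $\alpha$ be a smooth, simple, positively oriented, strictly convex closed curve in the plane: it is parametrized by a regular smooth injective map of the circle, it lies in the closed half-plane to the left of each of its oriented tangent lines, and its curvature is positive everywhere. For $r\ge 0$ let $\beta=\beta_r$ be the outer parallel curve $\beta_r=\alpha+r\,\mathbf N_{out}$, where $\mathbf N_{out}$ is the outward unit normal of $\alpha$. Then each $\beta_r$ is again such a curve, and its outward unit normal takes each value $(\cos\theta,\sin\theta)$ at exactly one point. Let $k_{\beta}(\theta)$ be the curvature of $\beta_r$ at that point, let $A_{\beta}>0$ be the area of the region enclosed by $\beta_r$, and put $$E(r)=\int_0^{2\pi}\log\left(k_{\beta}(\theta)\sqrt{\frac{A_{\beta}}{\pi}}\right)d\theta ,$$ the integrand being integrable. Then $E$ is differentiable on $[0,\infty)$ (one-sidedly at $r=0$) with $$\frac{d}{dr}E(r)\le 0\qquad\text{for all } r\in[0,\infty).$$ Hence $E$ is nonincreasing on $[0,\infty)$, it converges to $0$ as $r\to\infty$, and $E(r)\ge 0$ for all $r\ge 0$. In particular, every smooth strictly convex closed plane curve with curvature $k(\theta)$ at outward normal angle $\theta$ and enclosed area $A$ satisfies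 $$\int_0^{2\pi}\log\left(k(\theta)\sqrt{\frac{A}{\pi}}\right)d\theta\ge 0 .$$ -/

import Mathlib

open Complex MeasureTheory Filter Topology Set
open scoped ContDiff ComplexConjugate

/-! The Euclidean plane is `ℂ`. A closed curve is a `2π`-periodic map `ℝ → ℂ`, that is, a curve
parametrized by the circle `ℝ / 2πℤ`, with arbitrary (not necessarily constant) speed. -/

noncomputable section

namespace PlaneCurve

/-- The unit tangent vector. -/
def unitTangent (γ : ℝ → ℂ) (t : ℝ) : ℂ :=
  deriv γ t / (‖deriv γ t‖ : ℂ)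

/-- The unit normal to the right of the direction of motion; for a positively oriented simple
closed curve it is the outward normal. -/
def outwardNormal (γ : ℝ → ℂ) (t : ℝ) : ℂ :=
  -I * unitTangent γ t

/-- The signed curvature `det(γ', γ'') / |γ'|³`. -/
def curvature (γ : ℝ → ℂ) (t : ℝ) : ℝ :=
  (conj (deriv γ t) * deriv (deriv γ) t).im / ‖deriv γ t‖ ^ 3

/-- A smooth, simple, positively oriented, strictly convex closed plane curve. -/
structure IsStrictlyConvexClosedCurve (γ : ℝ → ℂ) : Prop where
  smooth : ContDiff ℝ ∞ γ
  closed : Function.Periodic γ (2 * Real.pi)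
  regular : ∀ t, deriv γ t ≠ 0
  simple : InjOn γ (Ico 0 (2 * Real.pi))
  /-- Convexity and positive orientation: the curve lies in the closed half-plane to the left of
  each of its oriented tangent lines. -/
  convex : ∀ t s, 0 ≤ (conj (deriv γ t) * (γ s - γ t)).im
  /-- Strict convexity: the curvature is positive everywhere. -/
  curvature_pos : ∀ t, 0 < curvature γ t

/-- The region enclosed by the curve: the points off the curve whose connected component in the
complement of the curve is bounded. -/
def enclosedRegion (γ : ℝ → ℂ) : Set ℂ :=
  {z | z ∉ range γ ∧ Bornology.IsBounded (connectedComponentIn (range γ)ᶜ z)}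

/-- The enclosed area: the Lebesgue measure of the enclosed region. -/
def enclosedArea (γ : ℝ → ℂ) : ℝ :=
  (volume (enclosedRegion γ)).toReal

/-- The parameter in `[0, 2π)` of the point of `γ` whose outward normal is `(cos θ, sin θ)`. -/
def paramOfNormalAngle (γ : ℝ → ℂ) (θ : ℝ) : ℝ :=
  Function.invFunOn (outwardNormal γ) (Ico 0 (2 * Real.pi)) (Complex.exp (θ * I))

/-- The curvature `k(θ)` as a function of the outward normal angle `θ`. -/
def curvatureAtNormalAngle (γ : ℝ → ℂ) (θ : ℝ) : ℝ :=
  curvature γ (paramOfNormalAngle γ θ)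

/-- The integrand `log (k(θ) √(A / π))` of the entropy. -/
def entropyDensity (γ : ℝ → ℂ) (θ : ℝ) : ℝ :=
  Real.log (curvatureAtNormalAngle γ θ * √(enclosedArea γ / Real.pi))

/-- The entropy `∫₀^{2π} log (k(θ) √(A / π)) dθ`. -/
def entropy (γ : ℝ → ℂ) : ℝ :=
  ∫ θ in (0 : ℝ)..(2 * Real.pi), entropyDensity γ θ

/-- The outer parallel curve at distance `r`. -/
def outerParallel (α : ℝ → ℂ) (r : ℝ) : ℝ → ℂ :=
  fun t => α t + r * outwardNormal α t

end PlaneCurve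

end

/-! ### Tangents, normals and the normal angle of a strictly convex curve. -/

namespace PlaneCurve

/-! Parametrize the curve by its outward normal angle θ, with radius of curvature ρ = 1/k, support
function h and L = ∫ρ. Passing to the outer parallel keeps the normal and adds r to both ρ and h.
Since the area is (1/2)∫hρ, Steiner's formula A_r = A + Lr + πr² follows, and the entropy becomes
E(r) = π log(A_r/π) − ∫ log(ρ + r), which is `steinerEntropy`. Its derivative is π L_r / A_r − ∫
1/(ρ + r) with L_r = L + 2πr, so E' ≤ 0 is exactly Gage's inequality π L_r ≤ A_r ∫ k_r dθ for the
parallel curve (`gage_inequality`). Both terms of E are 2π log r up to O(1/r), so E tends to 0, and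
a nonincreasing function with limit 0 is nonnegative.

Gage's inequality reduces to finding an origin with π∫h²ρ ≤ LA: expand ∫ (πhρ/A − 1)²/ρ ≥ 0. The
origin is the midpoint of a chord that joins points with opposite normals and bisects the area; it
exists by the intermediate value theorem. On each of the two half-periods h and h' agree at the
endpoints. A Wirtinger inequality for h − h(y), which vanishes at y, then gives π h(y)² ≤ 2H h(y) −
B, where H = ∫ρ and B = ∫hρ over the half-period. Integrating against ρ gives π∫h²ρ ≤ HB; bisection
makes B = A on both halves, and the two estimates add up.

The area formula needs the topologically defined enclosed region to be the intersection of the open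
tangent half-planes (`enclosedRegion_eq`), followed by a change of variables along rays from an
interior point (`volume_innerRegion`). -/

theorem deriv_eq_speed_mul_outwardNormal {γ : ℝ → ℂ} {t : ℝ} (h : deriv γ t ≠ 0) :
    deriv γ t = (‖deriv γ t‖ : ℂ) * (I * outwardNormal γ t) := by
  have h' : (‖deriv γ t‖ : ℂ) ≠ 0 := by simpa using h
  simp only [outwardNormal, unitTangent]
  field_simp
  simp

theorem norm_outwardNormal {γ : ℝ → ℂ} {t : ℝ} (h : deriv γ t ≠ 0) :
    ‖outwardNormal γ t‖ = 1 := by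
  simp [outwardNormal, unitTangent, h]

/-- Translates the determinant form of the half-plane condition into a sign condition on the height
in the direction of the outward normal. -/
theorem im_conj_deriv_mul {γ : ℝ → ℂ} {t : ℝ} (h : deriv γ t ≠ 0) (w : ℂ) :
    (conj (deriv γ t) * w).im = -(‖deriv γ t‖ * (conj (outwardNormal γ t) * w).re) := by
  conv_lhs => rw [deriv_eq_speed_mul_outwardNormal h]
  simp [-neg_add_rev]
  ring

theorem deriv_periodic {γ : ℝ → ℂ} {T : ℝ} (h : Function.Periodic γ T) :
    Function.Periodic (deriv γ) T := by
  intro t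
  rw [← deriv_comp_add_const γ T t]
  congr 1
  exact funext h

theorem curvature_periodic {γ : ℝ → ℂ} {T : ℝ} (h : Function.Periodic γ T) :
    Function.Periodic (curvature γ) T := fun t => by
  simp only [curvature, deriv_periodic h t, deriv_periodic (deriv_periodic h) t]

theorem outwardNormal_periodic {γ : ℝ → ℂ} {T : ℝ} (h : Function.Periodic γ T) :
    Function.Periodic (outwardNormal γ) T := fun t => by
  simp only [outwardNormal, unitTangent, deriv_periodic h t]

namespace IsStrictlyConvexClosedCurve

variable {γ : ℝ → ℂ} (hγ : IsStrictlyConvexClosedCurve γ)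

include hγ

theorem contDiff_deriv : ContDiff ℝ ∞ (deriv γ) :=
  (contDiff_infty_iff_deriv.1 hγ.smooth).2

theorem contDiff_deriv_deriv : ContDiff ℝ ∞ (deriv (deriv γ)) :=
  (contDiff_infty_iff_deriv.1 hγ.contDiff_deriv).2

theorem hasDerivAt (t : ℝ) : HasDerivAt γ (deriv γ t) t :=
  ((contDiff_infty_iff_deriv.1 hγ.smooth).1 t).hasDerivAt

theorem hasDerivAt_deriv (t : ℝ) : HasDerivAt (deriv γ) (deriv (deriv γ) t) t :=
  ((contDiff_infty_iff_deriv.1 hγ.contDiff_deriv).1 t).hasDerivAt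

theorem speed_pos (t : ℝ) : 0 < ‖deriv γ t‖ := norm_pos_iff.2 (hγ.regular t)

theorem im_conj_deriv_mul_deriv_deriv_pos (t : ℝ) :
    0 < (conj (deriv γ t) * deriv (deriv γ) t).im := by
  have h := hγ.curvature_pos t
  rw [curvature] at h
  exact (div_pos_iff_of_pos_right (pow_pos (hγ.speed_pos t) 3)).1 h

/-- A tangent line meets a strictly convex curve only at the point of tangency. -/
theorem eq_of_mem_tangent {s t : ℝ} (h : (conj (deriv γ t) * (γ s - γ t)).im = 0) :
    γ s = γ t := by
  -- As a function of the tangency point u, this determinant is nonnegative by convexity and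
  -- vanishes at t, so its derivative there is zero. Hence γ s − γ t has zero determinant with both
  -- γ' and γ'', which are independent because the curvature is positive.
  have hG : HasDerivAt (fun u => (conj (deriv γ u) * (γ s - γ u)).im)
      (conj (deriv (deriv γ) t) * (γ s - γ t) + conj (deriv γ t) * (-deriv γ t)).im t := by
    have h1 : HasDerivAt (fun u => conj (deriv γ u)) (conj (deriv (deriv γ) t)) t :=
      (hγ.hasDerivAt_deriv t).star
    have h2 := h1.mul ((hγ.hasDerivAt t).const_sub (γ s))
    exact Complex.imCLM.hasFDerivAt.comp_hasDerivAt t h2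
  have hmin : IsLocalMin (fun u => (conj (deriv γ u) * (γ s - γ u)).im) t :=
    Filter.Eventually.of_forall fun u => by
      simpa only [h] using hγ.convex u s
  have h0 := hmin.hasDerivAt_eq_zero hG
  have hpos := hγ.im_conj_deriv_mul_deriv_deriv_pos t
  have hreg : 0 < normSq (deriv γ t) := normSq_pos.2 (hγ.regular t)
  rw [← sub_eq_zero]
  generalize γ s - γ t = w at *
  generalize deriv γ t = p at *
  generalize deriv (deriv γ) t = q at *
  simp only [mul_im, add_im, conj_re, conj_im, neg_re, neg_im, normSq_apply] at *
  have e1 : (p.re * q.im - p.im * q.re) * w.re = 0 := by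
    linear_combination (-p.re) * h0 + q.re * h
  have e2 : (p.re * q.im - p.im * q.re) * w.im = 0 := by
    linear_combination (-p.im) * h0 + q.im * h
  have hne : p.re * q.im - p.im * q.re ≠ 0 := by linarith
  apply Complex.ext
  · simpa [hne] using e1
  · simpa [hne] using e2

theorem re_conj_outwardNormal_mul_nonpos (s t : ℝ) :
    (conj (outwardNormal γ t) * (γ s - γ t)).re ≤ 0 := by
  have h := hγ.convex t s
  rw [im_conj_deriv_mul (hγ.regular t)] at h
  have := hγ.speed_pos t
  by_contra hc
  push Not at hc
  nlinarith [mul_pos this hc]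

theorem eq_of_re_conj_outwardNormal_mul {s t : ℝ}
    (h : (conj (outwardNormal γ t) * (γ s - γ t)).re = 0) : γ s = γ t :=
  hγ.eq_of_mem_tangent (by rw [im_conj_deriv_mul (hγ.regular t), h]; simp)

theorem re_conj_outwardNormal_mul_neg {s t : ℝ} (h : γ s ≠ γ t) :
    (conj (outwardNormal γ t) * (γ s - γ t)).re < 0 :=
  lt_of_le_of_ne (hγ.re_conj_outwardNormal_mul_nonpos s t)
    fun h0 => h (hγ.eq_of_re_conj_outwardNormal_mul h0)

/-- With a common normal, the heights of each point over the other's tangent line are opposite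
numbers, and both are nonpositive. -/
theorem eq_of_outwardNormal_eq {s t : ℝ} (h : outwardNormal γ s = outwardNormal γ t) :
    γ s = γ t := by
  apply hγ.eq_of_re_conj_outwardNormal_mul
  have h1 := hγ.re_conj_outwardNormal_mul_nonpos s t
  have h2 := hγ.re_conj_outwardNormal_mul_nonpos t s
  rw [h, ← neg_sub (γ s), mul_neg, neg_re] at h2
  linarith

theorem exists_param_eq_add {s t : ℝ} (h : γ s = γ t) : ∃ k : ℤ, s = t + k * (2 * Real.pi) := by
  have hmem : ∀ u : ℝ, toIcoMod Real.two_pi_pos 0 u ∈ Ico 0 (2 * Real.pi) := fun u => by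
    simpa using toIcoMod_mem_Ico Real.two_pi_pos 0 u
  have hval : ∀ u : ℝ, γ (toIcoMod Real.two_pi_pos 0 u) = γ u := fun u => by
    rw [toIcoMod]
    exact hγ.closed.sub_zsmul_eq _
  have h1 := hγ.simple (hmem s) (hmem t) (by rw [hval, hval, h])
  simp only [toIcoMod, zsmul_eq_mul] at h1
  refine ⟨toIcoDiv Real.two_pi_pos 0 s - toIcoDiv Real.two_pi_pos 0 t, ?_⟩
  push_cast
  linarith

theorem outwardNormal_eq_of_eq {s t : ℝ} (h : γ s = γ t) :
    outwardNormal γ s = outwardNormal γ t := by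
  obtain ⟨k, rfl⟩ := hγ.exists_param_eq_add h
  exact (outwardNormal_periodic hγ.closed).int_mul k t

theorem curvature_eq_of_eq {s t : ℝ} (h : γ s = γ t) : curvature γ s = curvature γ t := by
  obtain ⟨k, rfl⟩ := hγ.exists_param_eq_add h
  exact (curvature_periodic hγ.closed).int_mul k t

/-- The speed of the normal angle. -/
theorem curvature_mul_speed (t : ℝ) :
    curvature γ t * ‖deriv γ t‖ = (deriv (deriv γ) t / deriv γ t).im := by
  have h := hγ.speed_pos t
  have h2 : normSq (deriv γ t) = ‖deriv γ t‖ ^ 2 := normSq_eq_norm_sq _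
  rw [curvature, div_im, h2]
  simp only [mul_im, conj_re, conj_im]
  field_simp
  ring

theorem continuous_curvature : Continuous (curvature γ) := by
  have h1 := hγ.contDiff_deriv.continuous
  have h2 := hγ.contDiff_deriv_deriv.continuous
  unfold curvature
  refine Continuous.div (by fun_prop) (by fun_prop) fun t => (pow_pos (hγ.speed_pos t) 3).ne'

/-- A lift of the outward normal to a normal angle. -/
theorem exists_normalAngle : ∃ φ : ℝ → ℝ,
    (∀ t, outwardNormal γ t = exp (φ t * I)) ∧
    ∀ t, HasDerivAt φ (curvature γ t * ‖deriv γ t‖) t := by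
  have hcont : Continuous fun t => deriv (deriv γ) t / deriv γ t :=
    hγ.contDiff_deriv_deriv.continuous.div hγ.contDiff_deriv.continuous hγ.regular
  -- A global logarithm of γ', obtained by integrating γ''/γ'; its imaginary part is a continuous
  -- tangent angle.
  set Z : ℝ → ℂ := fun t => log (deriv γ 0) + ∫ u in (0 : ℝ)..t, deriv (deriv γ) u / deriv γ u
    with hZ
  have hZd : ∀ t, HasDerivAt Z (deriv (deriv γ) t / deriv γ t) t := fun t =>
    (hcont.integral_hasStrictDerivAt 0 t).hasDerivAt.const_add _
  have hconst : ∀ t, deriv γ t * exp (-Z t) = deriv γ 0 * exp (-Z 0) := by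
    intro t
    have hd : ∀ u, HasDerivAt (fun u => deriv γ u * exp (-Z u)) 0 u := fun u => by
      convert! (hγ.hasDerivAt_deriv u).mul (hZd u).neg.cexp using 1
      rw [mul_neg, mul_neg, mul_left_comm, mul_div_cancel₀ _ (hγ.regular u)]
      ring
    exact is_const_of_deriv_eq_zero (fun u => (hd u).differentiableAt) (fun u => (hd u).deriv) t 0
  have hexp : ∀ t, deriv γ t = exp (Z t) := by
    intro t
    have h0 : deriv γ 0 * exp (-Z 0) = 1 := by
      simp [hZ, exp_neg, exp_log (hγ.regular 0), hγ.regular 0]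
    have h := hconst t
    rw [h0, exp_neg] at h
    field_simp at h
    exact h
  -- The outward normal is the tangent turned clockwise by a right angle.
  refine ⟨fun t => (Z t).im - Real.pi / 2, fun t => ?_, fun t => ?_⟩
  · rw [outwardNormal, unitTangent, hexp t, norm_exp, ofReal_exp, ← exp_sub]
    have h1 : Z t - ((Z t).re : ℂ) = (Z t).im * I := by
      apply Complex.ext <;> simp
    have h2 : exp (-(Real.pi / 2 * I)) = -I := by
      rw [exp_neg, exp_pi_div_two_mul_I, inv_I]
    rw [h1, ← h2, ← exp_add]
    congr 1
    push_cast
    ring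
  · rw [hγ.curvature_mul_speed]
    exact (Complex.imCLM.hasFDerivAt.comp_hasDerivAt t (hZd t)).sub_const _

theorem hasDerivAt_outwardNormal (t : ℝ) :
    HasDerivAt (outwardNormal γ)
      ((curvature γ t * ‖deriv γ t‖ : ℝ) * (I * outwardNormal γ t)) t := by
  obtain ⟨φ, h1, h2⟩ := hγ.exists_normalAngle
  have h3 : outwardNormal γ = fun t => exp (φ t * I) := funext h1
  rw [h3]
  convert ((h2 t).ofReal_comp.mul_const I).cexp using 1
  push_cast
  ring

/-- The inverse of the normal angle parametrizes the curve by its outward normal. -/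
theorem exists_inverse_normalAngle : ∃ τ : ℝ → ℝ,
    (∀ θ : ℝ, outwardNormal γ (τ θ) = exp (θ * I)) ∧
    ∀ θ, HasDerivAt τ (curvature γ (τ θ) * ‖deriv γ (τ θ)‖)⁻¹ θ := by
  obtain ⟨φ, h1, h2⟩ := hγ.exists_normalAngle
  have hw : ∀ t, 0 < curvature γ t * ‖deriv γ t‖ := fun t =>
    mul_pos (hγ.curvature_pos t) (hγ.speed_pos t)
  have hφc : Continuous φ := continuous_iff_continuousAt.2 fun t => (h2 t).continuousAt
  have hmono : StrictMono φ := strictMono_of_deriv_pos fun t => by rw [(h2 t).deriv]; exact hw t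
  -- Periodicity and compactness bound the angular speed below by a positive constant; the normal
  -- angle then grows at least linearly, which makes it surjective onto ℝ.
  obtain ⟨c, hc, hcw⟩ : ∃ c, 0 < c ∧ ∀ t, c ≤ curvature γ t * ‖deriv γ t‖ := by
    have hcont : Continuous fun t => curvature γ t * ‖deriv γ t‖ :=
      hγ.continuous_curvature.mul hγ.contDiff_deriv.continuous.norm
    have hper : Function.Periodic (fun t => curvature γ t * ‖deriv γ t‖) (2 * Real.pi) :=
      fun t => by
        simp only [curvature_periodic hγ.closed t, deriv_periodic hγ.closed t]
    obtain ⟨t₀, -, ht₀⟩ := (isCompact_Icc (a := (0 : ℝ)) (b := 2 * Real.pi)).exists_isMinOn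
      (nonempty_Icc.2 Real.two_pi_pos.le) hcont.continuousOn
    refine ⟨_, hw t₀, fun t => ?_⟩
    obtain ⟨y, hy, hy'⟩ := hper.exists_mem_Ico₀ Real.two_pi_pos t
    refine le_trans ?_ hy'.ge
    exact ht₀ (Ico_subset_Icc_self hy)
  have hgrow : ∀ s t, s ≤ t → c * (t - s) ≤ φ t - φ s := fun s t hst =>
    mul_sub_le_image_sub_of_le_deriv (fun u => (h2 u).differentiableAt)
      (fun u => by rw [(h2 u).deriv]; exact hcw u) hst
  have hsurj : Function.Surjective φ := by
    apply hφc.surjective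
    · refine tendsto_atTop_mono' _ (f₁ := fun t => c * t + φ 0) ?_ ?_
      · filter_upwards [eventually_ge_atTop 0] with t ht
        linarith [hgrow 0 t ht]
      · exact tendsto_atTop_add_const_right _ _ (tendsto_id.const_mul_atTop hc)
    · refine tendsto_atBot_mono' _ (f₁ := fun t => c * t + φ 0) ?_ ?_
      · filter_upwards [eventually_le_atBot 0] with t ht
        linarith [hgrow t 0 ht]
      · exact tendsto_atBot_add_const_right _ _ (tendsto_id.const_mul_atBot hc)
  let e := hmono.orderIsoOfSurjective φ hsurj
  have he : ∀ θ, φ (e.symm θ) = θ := fun θ => e.apply_symm_apply θ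
  refine ⟨e.symm, fun θ => by rw [h1, he], fun θ => ?_⟩
  exact HasDerivAt.of_local_left_inverse e.symm.continuous.continuousAt (h2 _) (hw _).ne'
    (Eventually.of_forall he)

theorem bijOn_outwardNormal :
    BijOn (outwardNormal γ) (Ico 0 (2 * Real.pi)) (Metric.sphere (0 : ℂ) 1) := by
  refine ⟨fun t _ => by simp [norm_outwardNormal (hγ.regular t)], fun s hs t ht hst =>
    hγ.simple hs ht (hγ.eq_of_outwardNormal_eq hst), fun z hz => ?_⟩
  obtain ⟨τ, hτ, -⟩ := hγ.exists_inverse_normalAngle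
  obtain ⟨y, hy, hy'⟩ :=
    (outwardNormal_periodic hγ.closed).exists_mem_Ico₀ Real.two_pi_pos (τ (arg z))
  refine ⟨y, hy, ?_⟩
  rw [← hy', hτ]
  have hz1 : ‖z‖ = 1 := by simpa using hz
  simpa [hz1] using norm_mul_exp_arg_mul_I z

/-- The parameter picked by `Function.invFunOn` may differ from t, but equal normals mean the same
point of the curve, and on a simple curve the point determines the curvature. -/
theorem curvatureAtNormalAngle_eq {θ t : ℝ} (h : outwardNormal γ t = exp (θ * I)) :
    curvatureAtNormalAngle γ θ = curvature γ t := by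
  have hmem : exp (θ * I) ∈ outwardNormal γ '' Ico 0 (2 * Real.pi) := by
    rw [hγ.bijOn_outwardNormal.image_eq]
    simp [norm_exp_ofReal_mul_I]
  have h1 : outwardNormal γ (paramOfNormalAngle γ θ) = exp (θ * I) :=
    Function.invFunOn_eq hmem
  exact hγ.curvature_eq_of_eq (hγ.eq_of_outwardNormal_eq (h1.trans h.symm))

theorem contDiff_outwardNormal : ContDiff ℝ ∞ (outwardNormal γ) := by
  have h1 := hγ.contDiff_deriv
  have h2 : ContDiff ℝ ∞ fun t => (‖deriv γ t‖ : ℂ) :=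
    ofRealCLM.contDiff.comp (h1.norm ℝ hγ.regular)
  have h3 : ContDiff ℝ ∞ fun t => (‖deriv γ t‖ : ℂ)⁻¹ :=
    h2.inv fun t => by simpa using hγ.regular t
  exact contDiff_const.mul (h1.mul h3)

theorem contDiff_outerParallel (r : ℝ) : ContDiff ℝ ∞ (outerParallel γ r) :=
  hγ.smooth.add (contDiff_const.mul hγ.contDiff_outwardNormal)

theorem parallel_speed_pos {r : ℝ} (hr : 0 ≤ r) (t : ℝ) :
    0 < ‖deriv γ t‖ * (1 + r * curvature γ t) :=
  mul_pos (hγ.speed_pos t) (by have := mul_nonneg hr (hγ.curvature_pos t).le; linarith)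

theorem deriv_outerParallel (r t : ℝ) :
    deriv (outerParallel γ r) t =
      (‖deriv γ t‖ * (1 + r * curvature γ t) : ℝ) * (I * outwardNormal γ t) := by
  have h := (hγ.hasDerivAt t).add ((hγ.hasDerivAt_outwardNormal t).const_mul (r : ℂ))
  have h' : HasDerivAt (outerParallel γ r) _ t := h
  rw [h'.deriv]
  have h1 := deriv_eq_speed_mul_outwardNormal (hγ.regular t)
  push_cast
  linear_combination h1

theorem norm_deriv_outerParallel {r : ℝ} (hr : 0 ≤ r) (t : ℝ) :
    ‖deriv (outerParallel γ r) t‖ = ‖deriv γ t‖ * (1 + r * curvature γ t) := by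
  rw [hγ.deriv_outerParallel, norm_mul, norm_mul, norm_outwardNormal (hγ.regular t), norm_I,
    norm_real, Real.norm_of_nonneg (hγ.parallel_speed_pos hr t).le]
  ring

theorem deriv_outerParallel_ne_zero {r : ℝ} (hr : 0 ≤ r) (t : ℝ) :
    deriv (outerParallel γ r) t ≠ 0 := by
  rw [← norm_pos_iff, hγ.norm_deriv_outerParallel hr]
  exact hγ.parallel_speed_pos hr t

theorem outwardNormal_outerParallel {r : ℝ} (hr : 0 ≤ r) :
    outwardNormal (outerParallel γ r) = outwardNormal γ := by
  funext t
  have h := hγ.parallel_speed_pos hr t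
  rw [outwardNormal, unitTangent, hγ.norm_deriv_outerParallel hr, hγ.deriv_outerParallel,
    mul_div_cancel_left₀ _ (ofReal_ne_zero.2 h.ne'), ← mul_assoc]
  simp

/-- Write the velocity as V·iN. In the determinant of velocity and acceleration the term with V' is
tangential and drops out, leaving V² times the angular speed of N, which does not depend on r. -/
theorem curvature_outerParallel {r : ℝ} (hr : 0 ≤ r) (t : ℝ) :
    curvature (outerParallel γ r) t = curvature γ t / (1 + r * curvature γ t) := by
  set V : ℝ → ℝ := fun u => ‖deriv (outerParallel γ r) u‖ with hV
  have hVd : DifferentiableAt ℝ V t :=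
    (((contDiff_infty_iff_deriv.1 (hγ.contDiff_outerParallel r)).2.norm ℝ
      (hγ.deriv_outerParallel_ne_zero hr)).differentiable (by simp)) t
  have hfun : deriv (outerParallel γ r) = fun u => (V u : ℂ) * (I * outwardNormal γ u) := by
    funext u
    rw [hV, hγ.deriv_outerParallel, ← hγ.norm_deriv_outerParallel hr]
  have hd := hVd.hasDerivAt.ofReal_comp.mul ((hγ.hasDerivAt_outwardNormal t).const_mul I)
  have hd' : deriv (deriv (outerParallel γ r)) t = ((deriv V t : ℝ) : ℂ) * (I * outwardNormal γ t) +
      (V t : ℂ) * (I * ((curvature γ t * ‖deriv γ t‖ : ℝ) * (I * outwardNormal γ t))) := by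
    conv_lhs => rw [hfun]
    exact hd.deriv
  have hVt : ‖deriv (outerParallel γ r) t‖ = V t := rfl
  have hVeq : V t = ‖deriv γ t‖ * (1 + r * curvature γ t) := hγ.norm_deriv_outerParallel hr t
  have hVpos : 0 < V t := hVeq ▸ hγ.parallel_speed_pos hr t
  have hN : (outwardNormal γ t).re ^ 2 + (outwardNormal γ t).im ^ 2 = 1 := by
    have h := normSq_eq_norm_sq (outwardNormal γ t)
    rw [norm_outwardNormal (hγ.regular t), normSq_apply] at h
    linarith
  have him : (conj (deriv (outerParallel γ r) t) * deriv (deriv (outerParallel γ r)) t).im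
      = V t ^ 2 * (curvature γ t * ‖deriv γ t‖) := by
    rw [hd', congrFun hfun t]
    generalize curvature γ t * ‖deriv γ t‖ = w
    simp
    linear_combination (V t ^ 2 * w) * hN
  rw [curvature, him, hVt]
  have h3 : 0 < 1 + r * curvature γ t := by
    have := mul_nonneg hr (hγ.curvature_pos t).le; linarith
  rw [div_eq_div_iff (by positivity) h3.ne']
  linear_combination (-(V t ^ 2 * curvature γ t)) * hVeq

theorem curvature_mul_speed_outerParallel {r : ℝ} (hr : 0 ≤ r) (t : ℝ) :
    curvature (outerParallel γ r) t * ‖deriv (outerParallel γ r) t‖ =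
      curvature γ t * ‖deriv γ t‖ := by
  have h3 : 0 < 1 + r * curvature γ t := by
    have := mul_nonneg hr (hγ.curvature_pos t).le; linarith
  rw [hγ.curvature_outerParallel hr, hγ.norm_deriv_outerParallel hr, mul_comm ‖deriv γ t‖,
    ← mul_assoc, div_mul_cancel₀ _ h3.ne']

/-- For r ≥ 0 the extra term is nonpositive, being r times a cosine minus one. Offsetting therefore
only pushes points further inside the tangent half-planes, and convexity and injectivity are
inherited. -/
theorem re_conj_outwardNormal_mul_outerParallel (r s t : ℝ) :
    (conj (outwardNormal γ t) * (outerParallel γ r s - outerParallel γ r t)).re =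
      (conj (outwardNormal γ t) * (γ s - γ t)).re +
        r * ((conj (outwardNormal γ t) * outwardNormal γ s).re - 1) := by
  have hN : (outwardNormal γ t).re ^ 2 + (outwardNormal γ t).im ^ 2 = 1 := by
    have h := normSq_eq_norm_sq (outwardNormal γ t)
    rw [norm_outwardNormal (hγ.regular t), normSq_apply] at h
    linarith
  simp [outerParallel]
  linear_combination (-r) * hN

theorem re_conj_outwardNormal_mul_outwardNormal_le (s t : ℝ) :
    (conj (outwardNormal γ t) * outwardNormal γ s).re ≤ 1 := by
  refine (re_le_norm _).trans ?_
  rw [norm_mul, RCLike.norm_conj, norm_outwardNormal (hγ.regular t),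
    norm_outwardNormal (hγ.regular s), one_mul]

/-- The outer parallels of a strictly convex curve are strictly convex. -/
theorem outerParallel {r : ℝ} (hr : 0 ≤ r) :
    IsStrictlyConvexClosedCurve (outerParallel γ r) where
  smooth := hγ.contDiff_outerParallel r
  closed t := by
    simp only [PlaneCurve.outerParallel, hγ.closed t, outwardNormal_periodic hγ.closed t]
  regular := hγ.deriv_outerParallel_ne_zero hr
  simple s hs t ht hst := by
    have h := hγ.re_conj_outwardNormal_mul_outerParallel r s t
    have h1 := hγ.re_conj_outwardNormal_mul_nonpos s t
    have h2 := mul_nonneg hr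
      (sub_nonneg.2 (hγ.re_conj_outwardNormal_mul_outwardNormal_le s t))
    rw [hst, sub_self, mul_zero, zero_re] at h
    exact hγ.simple hs ht (hγ.eq_of_re_conj_outwardNormal_mul (by linarith))
  convex t s := by
    have h := hγ.re_conj_outwardNormal_mul_outerParallel r s t
    have h1 := hγ.re_conj_outwardNormal_mul_nonpos s t
    have h2 := mul_nonneg hr
      (sub_nonneg.2 (hγ.re_conj_outwardNormal_mul_outwardNormal_le s t))
    rw [im_conj_deriv_mul (hγ.deriv_outerParallel_ne_zero hr t),
      hγ.outwardNormal_outerParallel hr, ← mul_neg]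
    exact mul_nonneg (norm_nonneg _) (by linarith)
  curvature_pos t := by
    rw [hγ.curvature_outerParallel hr]
    have := mul_nonneg hr (hγ.curvature_pos t).le
    exact div_pos (hγ.curvature_pos t) (by linarith)

end IsStrictlyConvexClosedCurve

end PlaneCurve

/-! ### Parametrization by the normal angle, and the support function. -/

namespace PlaneCurve

/-- `a` is a strictly convex closed curve parametrized by the angle `θ` of its outward normal, with
radius of curvature `ρ`. -/
structure IsNormalParam (a : ℝ → ℂ) (ρ : ℝ → ℝ) : Prop where
  hasDerivAt_re : ∀ θ, HasDerivAt (fun θ => (a θ).re) (-(ρ θ * Real.sin θ)) θ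
  hasDerivAt_im : ∀ θ, HasDerivAt (fun θ => (a θ).im) (ρ θ * Real.cos θ) θ
  continuous_radius : Continuous ρ
  radius_pos : ∀ θ, 0 < ρ θ
  periodic : Function.Periodic a (2 * Real.pi)
  radius_periodic : Function.Periodic ρ (2 * Real.pi)
  injOn : InjOn a (Ico 0 (2 * Real.pi))
  support_neg : ∀ s θ, a s ≠ a θ →
    Real.cos θ * ((a s).re - (a θ).re) + Real.sin θ * ((a s).im - (a θ).im) < 0

/-- The support function of the curve `a` with respect to the origin `o`. -/
noncomputable def support (a : ℝ → ℂ) (o : ℂ) (θ : ℝ) : ℝ :=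
  Real.cos θ * ((a θ).re - o.re) + Real.sin θ * ((a θ).im - o.im)

/-- The derivative of the support function. -/
noncomputable def supportDeriv (a : ℝ → ℂ) (o : ℂ) (θ : ℝ) : ℝ :=
  -Real.sin θ * ((a θ).re - o.re) + Real.cos θ * ((a θ).im - o.im)

namespace IsStrictlyConvexClosedCurve

variable {γ : ℝ → ℂ} (hγ : IsStrictlyConvexClosedCurve γ) {τ : ℝ → ℝ}
  (hN : ∀ θ : ℝ, outwardNormal γ (τ θ) = exp (θ * I))

include hγ hN

theorem range_comp_eq : range (fun θ => γ (τ θ)) = range γ := by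
  apply Subset.antisymm
  · rintro _ ⟨θ, rfl⟩
    exact ⟨τ θ, rfl⟩
  · rintro _ ⟨t, rfl⟩
    refine ⟨arg (outwardNormal γ t), hγ.eq_of_outwardNormal_eq ?_⟩
    have h := norm_mul_exp_arg_mul_I (outwardNormal γ t)
    rw [norm_outwardNormal (hγ.regular t), ofReal_one, one_mul] at h
    rw [hN, h]

theorem comp_periodic : Function.Periodic (fun θ => γ (τ θ)) (2 * Real.pi) := fun θ => by
  refine hγ.eq_of_outwardNormal_eq ?_
  rw [hN, hN]
  push_cast
  rw [add_mul, exp_add, exp_two_pi_mul_I, mul_one]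

/-- The normal angle moves at speed k|γ'|, so the velocity with respect to θ is the unit tangent
divided by k. -/
theorem isNormalParam
    (hτ : ∀ θ, HasDerivAt τ (curvature γ (τ θ) * ‖deriv γ (τ θ)‖)⁻¹ θ) :
    IsNormalParam (fun θ => γ (τ θ)) (fun θ => (curvature γ (τ θ))⁻¹) := by
  have hτc : Continuous τ := continuous_iff_continuousAt.2 fun t => (hτ t).continuousAt
  have hd : ∀ θ, HasDerivAt (fun θ => γ (τ θ))
      (((curvature γ (τ θ))⁻¹ : ℝ) * (I * exp (θ * I))) θ := fun θ => by
    have h := (hγ.hasDerivAt (τ θ)).scomp θ (hτ θ)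
    convert! h using 1
    have h1 := hγ.speed_pos (τ θ)
    have h2 := deriv_eq_speed_mul_outwardNormal (hγ.regular (τ θ))
    rw [hN] at h2
    rw [real_smul]
    conv_rhs => rw [h2, ← mul_assoc, ← ofReal_mul]
    congr 2
    rw [← h2, mul_inv, mul_assoc, inv_mul_cancel₀ h1.ne', mul_one]
  refine ⟨fun θ => ?_, fun θ => ?_, ?_, fun θ => inv_pos.2 (hγ.curvature_pos _),
    hγ.comp_periodic hN, fun θ => ?_, fun s hs t ht hst => ?_, fun s θ hs => ?_⟩
  · convert! Complex.reCLM.hasFDerivAt.comp_hasDerivAt θ (hd θ) using 1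
    simp [-ofReal_inv, exp_ofReal_mul_I_im]
  · convert! Complex.imCLM.hasFDerivAt.comp_hasDerivAt θ (hd θ) using 1
    simp [-ofReal_inv, exp_ofReal_mul_I_re]
  · exact (hγ.continuous_curvature.comp hτc).inv₀ fun θ => (hγ.curvature_pos _).ne'
  · exact congrArg _ (hγ.curvature_eq_of_eq (hγ.comp_periodic hN θ))
  · have h := hγ.outwardNormal_eq_of_eq hst
    rw [hN, hN] at h
    obtain ⟨n, hn⟩ := exp_eq_exp_iff_exists_int.1 h
    have hn' : s = t + n * (2 * Real.pi) := by
      have h2 := congrArg im hn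
      simpa using h2
    have h1 : (n : ℝ) * (2 * Real.pi) < 1 * (2 * Real.pi) := by linarith [hs.2, ht.1]
    have h2 : (-1) * (2 * Real.pi) < (n : ℝ) * (2 * Real.pi) := by linarith [hs.1, ht.2]
    have h3 := lt_of_mul_lt_mul_right h1 Real.two_pi_pos.le
    have h4 := lt_of_mul_lt_mul_right h2 Real.two_pi_pos.le
    have h5 : n = 0 := by
      have : n < 1 := by exact_mod_cast h3
      have : -1 < n := by exact_mod_cast h4
      omega
    simpa [h5] using hn'
  · have h := hγ.re_conj_outwardNormal_mul_neg hs
    rw [hN] at h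
    simpa [exp_ofReal_mul_I_re, exp_ofReal_mul_I_im] using h

end IsStrictlyConvexClosedCurve

namespace IsNormalParam

variable {a : ℝ → ℂ} {ρ : ℝ → ℝ} (ha : IsNormalParam a ρ)

include ha

theorem hasDerivAt_support (o : ℂ) (θ : ℝ) :
    HasDerivAt (support a o) (supportDeriv a o θ) θ := by
  convert! ((Real.hasDerivAt_cos θ).mul ((ha.hasDerivAt_re θ).sub_const o.re)).add
    ((Real.hasDerivAt_sin θ).mul ((ha.hasDerivAt_im θ).sub_const o.im)) using 1
  simp only [supportDeriv]
  ring

theorem hasDerivAt_supportDeriv (o : ℂ) (θ : ℝ) :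
    HasDerivAt (supportDeriv a o) (ρ θ - support a o θ) θ := by
  convert! ((Real.hasDerivAt_sin θ).neg.mul ((ha.hasDerivAt_re θ).sub_const o.re)).add
    ((Real.hasDerivAt_cos θ).mul ((ha.hasDerivAt_im θ).sub_const o.im)) using 1
  simp only [support, Pi.neg_apply]
  linear_combination (-ρ θ) * Real.sin_sq_add_cos_sq θ

theorem continuous_support (o : ℂ) : Continuous (support a o) :=
  continuous_iff_continuousAt.2 fun θ => (ha.hasDerivAt_support o θ).continuousAt

theorem continuous_re : Continuous fun θ => (a θ).re :=
  continuous_iff_continuousAt.2 fun θ => (ha.hasDerivAt_re θ).continuousAt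

theorem continuous_im : Continuous fun θ => (a θ).im :=
  continuous_iff_continuousAt.2 fun θ => (ha.hasDerivAt_im θ).continuousAt

theorem continuous : Continuous a :=
  equivRealProdCLM.symm.continuous.comp (ha.continuous_re.prodMk ha.continuous_im)

theorem support_periodic (o : ℂ) : Function.Periodic (support a o) (2 * Real.pi) := fun θ => by
  simp only [support, ha.periodic θ, Real.cos_add_two_pi, Real.sin_add_two_pi]

theorem supportDeriv_periodic (o : ℂ) :
    Function.Periodic (supportDeriv a o) (2 * Real.pi) := fun θ => by
  simp only [supportDeriv, ha.periodic θ, Real.cos_add_two_pi, Real.sin_add_two_pi]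

theorem support_nonpos (s θ : ℝ) :
    Real.cos θ * ((a s).re - (a θ).re) + Real.sin θ * ((a s).im - (a θ).im) ≤ 0 := by
  by_cases h : a s = a θ
  · simp [h]
  · exact (ha.support_neg s θ h).le

/-- A strictly convex curve has an interior point. -/
theorem exists_support_pos : ∃ o : ℂ, ∀ θ, 0 < support a o θ := by
  -- The two ends of this chord are distinct, so at each θ at least one of them differs from a θ and
  -- lies strictly inside the tangent half-plane; the midpoint does too.
  refine ⟨(a 0 + a Real.pi) / 2, fun θ => ?_⟩
  have hne : a 0 ≠ a Real.pi := fun h => Real.pi_pos.ne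
    (ha.injOn ⟨le_rfl, Real.two_pi_pos⟩ ⟨Real.pi_pos.le, by linarith [Real.pi_pos]⟩ h)
  have h0 := ha.support_nonpos 0 θ
  have h1 := ha.support_nonpos Real.pi θ
  have hre : ((a 0 + a Real.pi) / 2).re = ((a 0).re + (a Real.pi).re) / 2 := by simp
  have him : ((a 0 + a Real.pi) / 2).im = ((a 0).im + (a Real.pi).im) / 2 := by simp
  rw [support, hre, him]
  by_cases h : a 0 = a θ
  · have := ha.support_neg Real.pi θ (fun h' => hne (h.trans h'.symm))
    linarith
  · have := ha.support_neg 0 θ h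
    linarith

/-- Every ray from an interior point meets the curve. -/
theorem exists_eq_smul {o : ℂ} (ho : ∀ θ, 0 < support a o θ) {z : ℂ} (hz : z ≠ o) :
    ∃ m : ℝ, 0 < m ∧ ∃ θ ∈ Ico 0 (2 * Real.pi),
      z.re - o.re = m * ((a θ).re - o.re) ∧ z.im - o.im = m * ((a θ).im - o.im) := by
  set X : ℝ → ℝ := fun θ => Real.cos θ * (z.re - o.re) + Real.sin θ * (z.im - o.im) with hX
  -- The maximum of this quotient is the gauge of z − o. At a maximizer (X, X') = m (h, h'); these
  -- pairs are the coordinates of z − o and a θ − o in the frame turned by θ, so the two vectors are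
  -- proportional.
  set F : ℝ → ℝ := fun θ => X θ / support a o θ with hF
  have hXd : ∀ θ, HasDerivAt X
      (-Real.sin θ * (z.re - o.re) + Real.cos θ * (z.im - o.im)) θ := fun θ =>
    ((Real.hasDerivAt_cos θ).mul_const _).add ((Real.hasDerivAt_sin θ).mul_const _)
  have hXp : Function.Periodic X (2 * Real.pi) := fun θ => by
    simp only [hX, Real.cos_add_two_pi, Real.sin_add_two_pi]
  have hFp : Function.Periodic F (2 * Real.pi) := fun θ => by
    simp only [hF, hXp θ, ha.support_periodic o θ]
  have hFd : ∀ θ, HasDerivAt F _ θ := fun θ =>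
    (hXd θ).div (ha.hasDerivAt_support o θ) (ho θ).ne'
  have hFc : Continuous F := continuous_iff_continuousAt.2 fun θ => (hFd θ).continuousAt
  obtain ⟨θ₀, -, hθ₀⟩ := (isCompact_Icc (a := (0 : ℝ)) (b := 2 * Real.pi)).exists_isMaxOn
    (nonempty_Icc.2 Real.two_pi_pos.le) hFc.continuousOn
  have hmax' : ∀ θ, F θ ≤ F θ₀ := fun θ => by
    obtain ⟨y, hy, hy'⟩ := hFp.exists_mem_Ico₀ Real.two_pi_pos θ
    rw [hy']
    exact hθ₀ (Ico_subset_Icc_self hy)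
  obtain ⟨θ, hθ, hθ'⟩ := hFp.exists_mem_Ico₀ Real.two_pi_pos θ₀
  have hmax : ∀ s, F s ≤ F θ := fun s => hθ' ▸ hmax' s
  have hpos : 0 < F θ := by
    refine lt_of_lt_of_le ?_ (hmax (arg (z - o)))
    refine div_pos ?_ (ho _)
    have hn : 0 < ‖z - o‖ := norm_pos_iff.2 (sub_ne_zero.2 hz)
    have h1 : z.re - o.re = ‖z - o‖ * Real.cos (arg (z - o)) := by
      rw [norm_mul_cos_arg, sub_re]
    have h2 : z.im - o.im = ‖z - o‖ * Real.sin (arg (z - o)) := by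
      rw [norm_mul_sin_arg, sub_im]
    have h3 : X (arg (z - o)) = ‖z - o‖ := by
      simp only [hX]
      rw [h1, h2]
      linear_combination ‖z - o‖ * Real.sin_sq_add_cos_sq (arg (z - o))
    rwa [h3]
  have h0 := IsLocalMax.hasDerivAt_eq_zero (Eventually.of_forall hmax) (hFd θ)
  have hs := ho θ
  have h0' : (-Real.sin θ * (z.re - o.re) + Real.cos θ * (z.im - o.im)) * support a o θ -
      X θ * supportDeriv a o θ = 0 := by
    rcases div_eq_zero_iff.1 h0 with h | h
    · exact h
    · exact absurd h (by positivity)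
  have hm : X θ = F θ * support a o θ := (div_mul_cancel₀ _ hs.ne').symm
  have hm' : -Real.sin θ * (z.re - o.re) + Real.cos θ * (z.im - o.im)
      = F θ * supportDeriv a o θ := by
    apply mul_right_cancel₀ hs.ne'
    rw [hm] at h0'
    linear_combination h0'
  refine ⟨F θ, hpos, θ, hθ, ?_, ?_⟩
  · simp only [hX, support, supportDeriv] at hm hm'
    linear_combination Real.cos θ * hm - Real.sin θ * hm' +
      (F θ * ((a θ).re - o.re) - (z.re - o.re)) * Real.sin_sq_add_cos_sq θ
  · simp only [hX, support, supportDeriv] at hm hm'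
    linear_combination Real.sin θ * hm + Real.cos θ * hm' +
      (F θ * ((a θ).im - o.im) - (z.im - o.im)) * Real.sin_sq_add_cos_sq θ

end IsNormalParam

/-! ### The enclosed region and its area. -/

/-- The intersection of the open half-planes to the left of the tangent lines. -/
def innerRegion (a : ℝ → ℂ) : Set ℂ :=
  {z | ∀ θ, Real.cos θ * (z.re - (a θ).re) + Real.sin θ * (z.im - (a θ).im) < 0}

namespace IsNormalParam

variable {a : ℝ → ℂ} {ρ : ℝ → ℝ} (ha : IsNormalParam a ρ)

theorem mem_innerRegion_iff {o : ℂ} : o ∈ innerRegion a ↔ ∀ θ, 0 < support a o θ :=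
  forall_congr' fun θ => by
    rw [support]
    constructor <;> intro h <;> linarith

include ha

/-- An infinite intersection of open half-planes, but by periodicity the angle ranges over a compact
interval and the condition is jointly continuous. -/
theorem isOpen_innerRegion : IsOpen (innerRegion a) := by
  have heq : innerRegion a = {z | ∀ θ ∈ Icc 0 (2 * Real.pi), 0 < support a z θ} := by
    ext z
    rw [mem_innerRegion_iff]
    refine ⟨fun h θ _ => h θ, fun h θ => ?_⟩
    obtain ⟨y, hy, hy'⟩ := (ha.support_periodic z).exists_mem_Ico₀ Real.two_pi_pos θ
    rw [hy']
    exact h y (Ico_subset_Icc_self hy)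
  have hc : Continuous fun p : ℂ × ℝ => support a p.1 p.2 := by
    have h1 := ha.continuous
    unfold support
    fun_prop
  rw [heq, isOpen_iff_mem_nhds]
  intro z hz
  exact isCompact_Icc.eventually_forall_of_forall_eventually fun θ hθ =>
    hc.continuousAt.eventually (lt_mem_nhds (hz θ hθ))

theorem smul_mem_innerRegion {o : ℂ} (ho : ∀ θ, 0 < support a o θ) {z : ℂ} {m θ : ℝ}
    (hm0 : 0 < m) (hm : m < 1)
    (h1 : z.re - o.re = m * ((a θ).re - o.re)) (h2 : z.im - o.im = m * ((a θ).im - o.im)) :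
    z ∈ innerRegion a := by
  intro s
  have h3 := ha.support_nonpos θ s
  have h4 := ho s
  rw [support] at h4
  have e1 : z.re = o.re + m * ((a θ).re - o.re) := by linarith
  have e2 : z.im = o.im + m * ((a θ).im - o.im) := by linarith
  rw [e1, e2]
  nlinarith [mul_pos (sub_pos.2 hm) h4, mul_nonneg hm0.le (neg_nonneg.2 h3)]

theorem not_mem_range_of_lt {z : ℂ} {θ : ℝ}
    (h : 0 < Real.cos θ * (z.re - (a θ).re) + Real.sin θ * (z.im - (a θ).im)) : z ∉ range a := by
  rintro ⟨s, rfl⟩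
  exact absurd (ha.support_nonpos s θ) (not_le.2 h)

theorem isBounded_innerRegion : Bornology.IsBounded (innerRegion a) := by
  obtain ⟨C, hC⟩ : ∃ C, ∀ θ, support a 0 θ ≤ C := by
    obtain ⟨θ₀, -, hθ₀⟩ := (isCompact_Icc (a := (0 : ℝ)) (b := 2 * Real.pi)).exists_isMaxOn
      (nonempty_Icc.2 Real.two_pi_pos.le) (ha.continuous_support 0).continuousOn
    refine ⟨support a 0 θ₀, fun θ => ?_⟩
    obtain ⟨y, hy, hy'⟩ := (ha.support_periodic 0).exists_mem_Ico₀ Real.two_pi_pos θ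
    rw [hy']
    exact hθ₀ (Ico_subset_Icc_self hy)
  refine isBounded_iff_forall_norm_le.2 ⟨C, fun z hz => ?_⟩
  have h := hz (arg z)
  have hc := hC (arg z)
  have h1 := norm_mul_cos_arg z
  have h2 := norm_mul_sin_arg z
  simp only [support, zero_re, zero_im, sub_zero] at hc
  have h3 : Real.cos (arg z) * z.re + Real.sin (arg z) * z.im = ‖z‖ := by
    conv_lhs => rw [← h1, ← h2]
    linear_combination ‖z‖ * Real.sin_sq_add_cos_sq (arg z)
  linarith

/-- The complement of the curve is covered by two disjoint open sets: the bounded inner region and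
the union of the open outer half-planes. A component meeting the first stays in it. From a point of
the second, the ray pointing away from an interior point never meets the curve, so its component is
unbounded. -/
theorem enclosedRegion_eq {γ : ℝ → ℂ} (hrange : range a = range γ) :
    enclosedRegion γ = innerRegion a := by
  obtain ⟨o, ho⟩ := ha.exists_support_pos
  have hoI : o ∈ innerRegion a := mem_innerRegion_iff.2 ho
  set X : Set ℂ := ⋃ θ, {z : ℂ | 0 < Real.cos θ * (z.re - (a θ).re) +
    Real.sin θ * (z.im - (a θ).im)} with hX
  have hXo : IsOpen X := isOpen_iUnion fun θ =>
    isOpen_lt continuous_const (by fun_prop)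
  have hcover : (range a)ᶜ ⊆ innerRegion a ∪ X := by
    intro z hz
    by_cases hzo : z = o
    · exact Or.inl (hzo ▸ hoI)
    obtain ⟨m, hm, θ, -, h1, h2⟩ := ha.exists_eq_smul ho hzo
    rcases lt_trichotomy m 1 with hm1 | hm1 | hm1
    · exact Or.inl (ha.smul_mem_innerRegion ho hm hm1 h1 h2)
    · refine absurd ⟨θ, ?_⟩ hz
      subst hm1
      apply Complex.ext <;> linarith
    · refine Or.inr (mem_iUnion.2 ⟨θ, ?_⟩)
      have h4 := ho θ
      rw [support] at h4
      have e1 : z.re = o.re + m * ((a θ).re - o.re) := by linarith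
      have e2 : z.im = o.im + m * ((a θ).im - o.im) := by linarith
      rw [mem_ofPred_eq, e1, e2]
      nlinarith [mul_pos (sub_pos.2 hm1) h4]
  have hdisj : innerRegion a ∩ X = ∅ := by
    ext z
    simp only [mem_inter_iff, mem_empty_iff_false, iff_false, not_and]
    rintro hz hz'
    obtain ⟨θ, hθ⟩ := mem_iUnion.1 hz'
    exact absurd (hz θ) (not_lt.2 (le_of_lt hθ))
  have hIr : innerRegion a ⊆ (range a)ᶜ := by
    rintro z hz ⟨θ, rfl⟩
    simpa using hz θ
  ext z
  rw [enclosedRegion, ← hrange]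
  constructor
  · rintro ⟨hz, hb⟩
    rcases hcover hz with h | h
    · exact h
    exfalso
    obtain ⟨θ, hθ⟩ := mem_iUnion.1 h
    rw [mem_ofPred_eq] at hθ
    have hθo := ho θ
    rw [support] at hθo
    have hzo : z - o ≠ 0 := by
      intro h0
      rw [sub_eq_zero] at h0
      subst h0
      linarith
    have hray : ∀ c : ℝ, 0 ≤ c → z + c * (z - o) ∈ connectedComponentIn (range a)ᶜ z := by
      intro c hc
      have hpre : IsPreconnected ((fun c : ℝ => z + c * (z - o)) '' Ici 0) :=
        isPreconnected_Ici.image _ (by fun_prop)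
      refine hpre.subset_connectedComponentIn ⟨0, by simp, by simp⟩ ?_ ⟨c, hc, rfl⟩
      rintro _ ⟨d, hd, rfl⟩
      refine ha.not_mem_range_of_lt (θ := θ) ?_
      have hd' : (0 : ℝ) ≤ d := hd
      simp only [add_re, mul_re, ofReal_re, ofReal_im, sub_re, sub_im, add_im, mul_im, zero_mul,
        sub_zero, add_zero]
      nlinarith [mul_nonneg hd' hθ.le, mul_nonneg hd' hθo.le]
    obtain ⟨C, hC⟩ := isBounded_iff_forall_norm_le.1 hb
    have hn : 0 < ‖z - o‖ := norm_pos_iff.2 hzo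
    have hC0 : 0 ≤ C + ‖z‖ + 1 := by
      have := hC z (mem_connectedComponentIn hz)
      linarith [norm_nonneg z]
    have h1 := hC _ (hray ((C + ‖z‖ + 1) / ‖z - o‖) (by positivity))
    have h2 : ‖((((C + ‖z‖ + 1) / ‖z - o‖ : ℝ) : ℂ) * (z - o))‖ = C + ‖z‖ + 1 := by
      rw [norm_mul, norm_real, Real.norm_of_nonneg (by positivity)]
      field_simp
    have h3 := norm_sub_le (z + (((C + ‖z‖ + 1) / ‖z - o‖ : ℝ) : ℂ) * (z - o)) z
    rw [add_sub_cancel_left, h2] at h3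
    linarith
  · intro hz
    refine ⟨hIr hz, ha.isBounded_innerRegion.subset ?_⟩
    have hpre := isPreconnected_connectedComponentIn (F := (range a)ᶜ) (x := z)
    refine hpre.subset_left_of_subset_union ha.isOpen_innerRegion hXo
      (disjoint_iff_inter_eq_empty.2 hdisj)
      ((connectedComponentIn_subset _ _).trans hcover) ⟨z, mem_connectedComponentIn (hIr hz), hz⟩

/-- The area of a strictly convex region in terms of its support function. -/
theorem volume_innerRegion {o : ℂ} (ho : ∀ θ, 0 < support a o θ) :
    (volume (innerRegion a)).toReal =
      (1 / 2) * ∫ θ in (0 : ℝ)..(2 * Real.pi), support a o θ * ρ θ := by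
  -- Polar-type coordinates (m, θ) ↦ o + m (a θ − o), with Jacobian m h ρ. The m-integral over (0,
  -- 1) produces the factor 1/2, and the image misses only the point o.
  set f : ℝ × ℝ → ℝ × ℝ := fun p =>
    (p.1 * ((a p.2).re - o.re) + o.re, p.1 * ((a p.2).im - o.im) + o.im) with hf
  set S : Set (ℝ × ℝ) := Ioo (0 : ℝ) 1 ×ˢ Ico 0 (2 * Real.pi) with hS
  set f' : ℝ × ℝ → (ℝ × ℝ →L[ℝ] ℝ × ℝ) := fun p =>
    (Matrix.toLin (.finTwoProd ℝ) (.finTwoProd ℝ)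
      !![(a p.2).re - o.re, -p.1 * (ρ p.2 * Real.sin p.2);
        (a p.2).im - o.im, p.1 * (ρ p.2 * Real.cos p.2)]).toContinuousLinearMap with hf'
  have hderiv : ∀ p, HasFDerivAt f (f' p) p := by
    intro p
    simp only [hf']
    rw [Matrix.toLin_finTwoProd_toContinuousLinearMap]
    convert! HasFDerivAt.prodMk (𝕜 := ℝ)
      ((hasFDerivAt_fst.mul (((ha.hasDerivAt_re p.2).sub_const o.re).comp_hasFDerivAt p
        hasFDerivAt_snd)).add_const o.re)
      ((hasFDerivAt_fst.mul (((ha.hasDerivAt_im p.2).sub_const o.im).comp_hasFDerivAt p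
        hasFDerivAt_snd)).add_const o.im) using 2 <;>
    simp [smul_smul, add_comm, neg_mul, smul_neg, neg_smul _ (ContinuousLinearMap.snd ℝ ℝ ℝ)]
  have hdet : ∀ p, (f' p).det = p.1 * (support a o p.2 * ρ p.2) := by
    intro p
    rw [hf', LinearMap.det_toContinuousLinearMap, LinearMap.det_toLin, Matrix.det_fin_two_of,
      support]
    ring
  have hinj : InjOn f S := by
    -- Pair the equality with the normal at s: the left side becomes c h(s), while the right side is
    -- at most d h(s).
    have key : ∀ p ∈ S, ∀ q ∈ S, f p = f q → p.1 ≤ q.1 := by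
      rintro ⟨c, s⟩ ⟨hc, -⟩ ⟨d, t⟩ ⟨hd, -⟩ hpq
      simp only [hf, Prod.mk.injEq] at hpq
      obtain ⟨h1, h2⟩ := hpq
      have h3 := ha.support_nonpos t s
      have h4 := ho s
      rw [support] at h4
      simp only at hc hd ⊢
      have h5 : c * (Real.cos s * ((a s).re - o.re) + Real.sin s * ((a s).im - o.im)) =
          d * (Real.cos s * ((a t).re - o.re) + Real.sin s * ((a t).im - o.im)) := by
        linear_combination Real.cos s * h1 + Real.sin s * h2
      refine le_of_mul_le_mul_right ?_ h4
      rw [h5]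
      exact mul_le_mul_of_nonneg_left (by linarith) hd.1.le
    intro p hp q hq hpq
    have h1 : p.1 = q.1 := le_antisymm (key p hp q hq hpq) (key q hq p hp hpq.symm)
    refine Prod.ext h1 (ha.injOn hp.2 hq.2 ?_)
    simp only [hf, Prod.mk.injEq, h1] at hpq
    have hq0 : q.1 ≠ 0 := hq.1.1.ne'
    apply Complex.ext
    · simpa [hq0] using hpq.1
    · simpa [hq0] using hpq.2
  have himage : f '' S = measurableEquivRealProd.symm ⁻¹' (innerRegion a \ {o}) := by
    ext p
    constructor
    · rintro ⟨⟨m, θ⟩, ⟨hm, hθ⟩, rfl⟩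
      refine ⟨ha.smul_mem_innerRegion ho (m := m) (θ := θ) hm.1 hm.2 (by simp [hf])
        (by simp [hf]), fun hz => ?_⟩
      have hz' : measurableEquivRealProd.symm (f (m, θ)) = o := hz
      have h1 := congrArg re hz'
      have h2 := congrArg im hz'
      have hm0 : m ≠ 0 := hm.1.ne'
      simp [hf, hm0] at h1 h2
      have h3 := ho θ
      simp [support, h1, h2] at h3
    · rintro ⟨hz, hzo⟩
      obtain ⟨m, hm, θ, hθ, h1, h2⟩ := ha.exists_eq_smul ho hzo
      have hm1 : m < 1 := by
        have h3 := hz θ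
        have h4 := ho θ
        rw [support] at h4
        have e1 : (measurableEquivRealProd.symm p).re = o.re + m * ((a θ).re - o.re) := by linarith
        have e2 : (measurableEquivRealProd.symm p).im = o.im + m * ((a θ).im - o.im) := by linarith
        rw [e1, e2] at h3
        by_contra hc
        push Not at hc
        nlinarith [mul_nonneg (sub_nonneg.2 hc) h4.le]
      refine ⟨(m, θ), ⟨⟨hm, hm1⟩, hθ⟩, ?_⟩
      simp only [measurableEquivRealProd_symm_apply] at h1 h2
      apply Prod.ext
      · simp only [hf]; linarith
      · simp only [hf]; linarith
  have hSm : MeasurableSet S := measurableSet_Ioo.prod measurableSet_Ico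
  have hvol : volume (innerRegion a) = volume (f '' S) := by
    rw [himage, volume_preserving_equiv_real_prod.symm.measure_preimage_equiv,
      measure_sdiff_null (measure_singleton o)]
  have hint := integral_image_eq_integral_abs_det_fderiv_smul volume hSm
    (fun p _ => (hderiv p).hasFDerivWithinAt) hinj (fun _ => (1 : ℝ))
  have hcongr : ∫ p in S, |(f' p).det| • (1 : ℝ) =
      ∫ p in S, p.1 * (support a o p.2 * ρ p.2) := by
    refine setIntegral_congr_fun hSm fun p hp => ?_
    have h0 : 0 ≤ p.1 * (support a o p.2 * ρ p.2) :=
      mul_nonneg hp.1.1.le (mul_nonneg (ho _).le (ha.radius_pos _).le)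
    simp only [hdet, abs_of_nonneg h0, smul_eq_mul, mul_one]
  rw [hcongr, setIntegral_const, hS, Measure.volume_eq_prod,
    setIntegral_prod_mul (fun x : ℝ => x) (fun θ => support a o θ * ρ θ),
    ← integral_Ioc_eq_integral_Ioo, ← intervalIntegral.integral_of_le zero_le_one, integral_id,
    integral_Ico_eq_integral_Ioo, ← integral_Ioc_eq_integral_Ioo,
    ← intervalIntegral.integral_of_le Real.two_pi_pos.le] at hint
  rw [hvol]
  simp only [smul_eq_mul, mul_one, Measure.real] at hint
  rw [Measure.volume_eq_prod, hint]
  norm_num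

/-- The integral `∫ h ρ` over a period does not depend on the origin. -/
theorem integral_support_mul_radius (o : ℂ) (x : ℝ) :
    ∫ θ in x..(x + 2 * Real.pi), support a o θ * ρ θ =
      ∫ θ in (0 : ℝ)..(2 * Real.pi), support a 0 θ * ρ θ := by
  have hp : Function.Periodic (fun θ => support a o θ * ρ θ) (2 * Real.pi) := fun θ => by
    simp only [ha.support_periodic o θ, ha.radius_periodic θ]
  have hρ := ha.continuous_radius
  have h1 : ∫ θ in (0 : ℝ)..(2 * Real.pi), ρ θ * Real.cos θ = 0 := by
    rw [intervalIntegral.integral_eq_sub_of_hasDerivAt (fun θ _ => ha.hasDerivAt_im θ)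
      ((by fun_prop : Continuous _).intervalIntegrable _ _)]
    have := ha.periodic 0
    rw [zero_add] at this
    rw [this, sub_self]
  have h2 : ∫ θ in (0 : ℝ)..(2 * Real.pi), -(ρ θ * Real.sin θ) = 0 := by
    rw [intervalIntegral.integral_eq_sub_of_hasDerivAt (fun θ _ => ha.hasDerivAt_re θ)
      ((by fun_prop : Continuous _).intervalIntegrable _ _)]
    have := ha.periodic 0
    rw [zero_add] at this
    rw [this, sub_self]
  have hs := ha.continuous_support 0
  have hz := hp.intervalIntegral_add_eq x 0
  rw [zero_add] at hz
  rw [hz]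
  -- Moving the origin adds multiples of ρ cos and ρ sin, the derivatives of the coordinates up to
  -- sign, which integrate to zero over a period.
  have hfun : ∀ θ, support a o θ * ρ θ = support a 0 θ * ρ θ - o.re * (ρ θ * Real.cos θ)
      + o.im * (-(ρ θ * Real.sin θ)) := fun θ => by
    simp only [support, zero_re, zero_im]
    ring
  simp only [hfun]
  rw [intervalIntegral.integral_add, intervalIntegral.integral_sub,
    intervalIntegral.integral_const_mul, intervalIntegral.integral_const_mul, h1, h2]
  · ring
  all_goals exact (by fun_prop : Continuous _).intervalIntegrable _ _

theorem enclosedArea_eq {γ : ℝ → ℂ} (hrange : range a = range γ) :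
    enclosedArea γ = (1 / 2) * ∫ θ in (0 : ℝ)..(2 * Real.pi), support a 0 θ * ρ θ := by
  obtain ⟨o, ho⟩ := ha.exists_support_pos
  rw [enclosedArea, ha.enclosedRegion_eq hrange, ha.volume_innerRegion ho,
    ← ha.integral_support_mul_radius o 0, zero_add]

theorem integral_support_mul_radius_pos :
    0 < ∫ θ in (0 : ℝ)..(2 * Real.pi), support a 0 θ * ρ θ := by
  obtain ⟨o, ho⟩ := ha.exists_support_pos
  rw [← ha.integral_support_mul_radius o 0, zero_add]
  exact intervalIntegral.intervalIntegral_pos_of_pos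
    (((ha.continuous_support o).mul ha.continuous_radius).intervalIntegrable _ _)
    (fun θ => mul_pos (ho θ) (ha.radius_pos θ)) Real.two_pi_pos

end IsNormalParam

end PlaneCurve

/-! ### Wirtinger inequalities and the second moment of the support function. -/

namespace PlaneCurve

section Wirtinger

variable {g g' : ℝ → ℝ}

/-- A one-sided Wirtinger inequality for functions vanishing at the left endpoint. -/
theorem sq_mul_cot_le_integral_left (hg : ∀ x, HasDerivAt g (g' x) x) (hg' : Continuous g')
    {x y : ℝ} (hx : g x = 0) (hxy : x < y) (hy : y < x + Real.pi) :
    g y ^ 2 * (Real.cos (y - x) / Real.sin (y - x)) ≤ ∫ u in x..y, (g' u ^ 2 - g u ^ 2) := by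
  have hgc : Continuous g := continuous_iff_continuousAt.2 fun u => (hg u).continuousAt
  have hc : Continuous fun u => g' u ^ 2 - g u ^ 2 := by fun_prop
  -- The derivative of F is the perfect square (g' − g cot)², so F increases.
  set F : ℝ → ℝ := fun v => (∫ u in x..v, (g' u ^ 2 - g u ^ 2)) -
    g v ^ 2 * (Real.cos (v - x) / Real.sin (v - x)) with hF
  have hsin : ∀ v ∈ Ioo x (x + Real.pi), 0 < Real.sin (v - x) := fun v hv =>
    Real.sin_pos_of_pos_of_lt_pi (by linarith [hv.1]) (by linarith [hv.2])
  have hFd : ∀ v ∈ Ioo x (x + Real.pi),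
      HasDerivAt F ((g' v - g v * (Real.cos (v - x) / Real.sin (v - x))) ^ 2) v := by
    intro v hv
    have hs := (hsin v hv).ne'
    have h1 := (hc.integral_hasStrictDerivAt x v).hasDerivAt
    have h2 : HasDerivAt (fun v => v - x) 1 v := (hasDerivAt_id v).sub_const x
    convert! h1.sub (((hg v).pow 2).mul (h2.cos.div h2.sin hs)) using 1
    simp only [Pi.pow_apply, Pi.div_apply]
    field_simp
    ring
  have hmono : MonotoneOn F (Ioo x (x + Real.pi)) := by
    refine monotoneOn_of_deriv_nonneg (convex_Ioo _ _)
      (fun v hv => (hFd v hv).continuousAt.continuousWithinAt)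
      (fun v hv => ?_) (fun v hv => ?_)
    · rw [interior_Ioo] at hv
      exact (hFd v hv).differentiableAt.differentiableWithinAt
    · rw [interior_Ioo] at hv
      rw [(hFd v hv).deriv]
      positivity
  -- The cotangent is singular at x, but g vanishes there: g² cot equals g cos times the ratio of
  -- the slopes of g and sin, which tends to 0.
  have hlim : Tendsto F (𝓝[>] x) (𝓝 0) := by
    have h1 : Tendsto (fun v => ∫ u in x..v, (g' u ^ 2 - g u ^ 2)) (𝓝[>] x) (𝓝 0) := by
      have := (hc.integral_hasStrictDerivAt x x).hasDerivAt.continuousAt.tendsto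
      rw [intervalIntegral.integral_same] at this
      exact this.mono_left nhdsWithin_le_nhds
    have hle : 𝓝[>] x ≤ 𝓝[≠] x := nhdsWithin_mono x fun v hv => ne_of_gt hv
    have h2 : Tendsto (slope g x) (𝓝[>] x) (𝓝 (g' x)) :=
      (hasDerivAt_iff_tendsto_slope.1 (hg x)).mono_left hle
    have hs : HasDerivAt (fun v => Real.sin (v - x)) 1 x := by
      simpa using ((hasDerivAt_id x).sub_const x).sin
    have h3 : Tendsto (slope (fun v => Real.sin (v - x)) x) (𝓝[>] x) (𝓝 1) :=
      (hasDerivAt_iff_tendsto_slope.1 hs).mono_left hle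
    have h4 : Tendsto (fun v => g v * Real.cos (v - x)) (𝓝[>] x) (𝓝 0) := by
      have h : Continuous fun v => g v * Real.cos (v - x) := by fun_prop
      have := h.tendsto x
      rw [hx, zero_mul] at this
      exact this.mono_left nhdsWithin_le_nhds
    have h5 := h1.sub ((h4.mul h2).div h3 one_ne_zero)
    simp only [zero_mul, zero_div, sub_zero] at h5
    refine h5.congr' ?_
    filter_upwards [self_mem_nhdsWithin, Ioo_mem_nhdsGT (lt_add_of_pos_right x Real.pi_pos)]
      with v hv hv'
    have hvx : v - x ≠ 0 := sub_ne_zero.2 (ne_of_gt hv)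
    have hs := (hsin v hv').ne'
    simp only [hF, slope_def_field, hx, sub_zero, sub_self, Real.sin_zero, Pi.div_apply]
    congr 1
    field_simp
  have h0 : 0 ≤ F y := by
    refine le_of_tendsto hlim ?_
    filter_upwards [Ioo_mem_nhdsGT hxy] with v hv
    exact hmono ⟨hv.1, hv.2.trans hy⟩ ⟨hxy, hy⟩ hv.2.le
  simp only [hF] at h0
  linarith

/-- A one-sided Wirtinger inequality for functions vanishing at the right endpoint. -/
theorem sq_mul_cot_le_integral_right (hg : ∀ x, HasDerivAt g (g' x) x) (hg' : Continuous g')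
    {x y : ℝ} (hy : g y = 0) (hxy : x < y) (hx : y < x + Real.pi) :
    g x ^ 2 * (Real.cos (y - x) / Real.sin (y - x)) ≤ ∫ u in x..y, (g' u ^ 2 - g u ^ 2) := by
  have h := sq_mul_cot_le_integral_left (g := fun u => g (-u)) (g' := fun u => -g' (-u))
    (x := -y) (y := -x)
    (fun u => by convert! (hg (-u)).scomp u (hasDerivAt_neg u) using 1; simp) (by fun_prop)
    (by simpa using hy) (by linarith) (by linarith)
  have h1 := intervalIntegral.integral_comp_neg (a := -y) (b := -x)
    (fun u => g' u ^ 2 - g u ^ 2)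
  simp only [neg_neg] at h1
  simp only [neg_neg, neg_sq, h1] at h
  rwa [show -x - -y = y - x by ring] at h

/-- Split the interval at the zero y. The endpoint values of g agree and cot(π − u) = −cot u, so the
two boundary terms cancel. -/
theorem integral_sq_sub_sq_nonneg (hg : ∀ x, HasDerivAt g (g' x) x) (hg' : Continuous g')
    {x y : ℝ} (hy : g y = 0) (hxy : x < y) (hyx : y < x + Real.pi) (h : g (x + Real.pi) = g x) :
    0 ≤ ∫ u in x..(x + Real.pi), (g' u ^ 2 - g u ^ 2) := by
  have hgc : Continuous g := continuous_iff_continuousAt.2 fun u => (hg u).continuousAt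
  have hc : Continuous fun u => g' u ^ 2 - g u ^ 2 := by fun_prop
  rw [← intervalIntegral.integral_add_adjacent_intervals (hc.intervalIntegrable x y)
    (hc.intervalIntegrable y _)]
  have h1 := sq_mul_cot_le_integral_right hg hg' hy hxy hyx
  have h2 := sq_mul_cot_le_integral_left hg hg' hy hyx (by linarith)
  rw [h, show x + Real.pi - y = Real.pi - (y - x) by ring, Real.cos_pi_sub, Real.sin_pi_sub,
    neg_div, mul_neg] at h2
  linarith

end Wirtinger

/-- A bound for the second moment of the support function on a half-period whose endpoints are
opposite with respect to the origin. -/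
theorem integral_sq_mul_radius_le {h q ρ : ℝ → ℝ} (hh : ∀ x, HasDerivAt h (q x) x)
    (hq : ∀ x, HasDerivAt q (ρ x - h x) x) (hρ : Continuous ρ) (hρ0 : ∀ x, 0 < ρ x) {x : ℝ}
    (hx : h (x + Real.pi) = h x) (hqx : q (x + Real.pi) = q x) :
    Real.pi * ∫ u in x..(x + Real.pi), h u ^ 2 * ρ u ≤
      (∫ u in x..(x + Real.pi), ρ u) * ∫ u in x..(x + Real.pi), h u * ρ u := by
  have hhc : Continuous h := continuous_iff_continuousAt.2 fun u => (hh u).continuousAt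
  have hqc : Continuous q := continuous_iff_continuousAt.2 fun u => (hq u).continuousAt
  set B := ∫ u in x..(x + Real.pi), h u * ρ u with hB
  set H := ∫ u in x..(x + Real.pi), ρ u with hH
  have hI : ∀ {f : ℝ → ℝ}, Continuous f → IntervalIntegrable f volume x (x + Real.pi) :=
    fun hf => hf.intervalIntegrable _ _
  have hH' : ∫ u in x..(x + Real.pi), h u = H := by
    have h1 : ∫ u in x..(x + Real.pi), (ρ u - h u) = 0 := by
      rw [intervalIntegral.integral_eq_sub_of_hasDerivAt (fun u _ => hq u)
        (hI (by fun_prop)), hqx, sub_self]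
    rw [intervalIntegral.integral_sub (hI hρ) (hI hhc)] at h1
    linarith
  have hB' : ∫ u in x..(x + Real.pi), (q u ^ 2 - h u ^ 2) = -B := by
    have h1 : ∫ u in x..(x + Real.pi), (q u * q u + h u * (ρ u - h u)) = 0 := by
      rw [intervalIntegral.integral_eq_sub_of_hasDerivAt (fun u _ => (hh u).mul (hq u))
        (hI (by fun_prop))]
      simp [hx, hqx]
    have h2 : ∀ u, q u * q u + h u * (ρ u - h u) = (q u ^ 2 - h u ^ 2) + h u * ρ u :=
      fun u => by ring
    simp only [h2] at h1
    rw [intervalIntegral.integral_add (hI (by fun_prop)) (hI (by fun_prop))] at h1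
    linarith
  -- The Wirtinger inequality for h − h y, expanded. Multiplied by ρ and integrated, its right-hand
  -- side becomes 2HB − BH = HB.
  have hpt : ∀ y ∈ Ioo x (x + Real.pi), Real.pi * h y ^ 2 ≤ 2 * H * h y - B := by
    intro y hy
    have h1 := integral_sq_sub_sq_nonneg (g := fun u => h u - h y) (g' := q)
      (fun u => (hh u).sub_const _) hqc (x := x) (y := y) (sub_self _) hy.1 hy.2 (by rw [hx])
    have h2 : ∀ u, q u ^ 2 - (h u - h y) ^ 2 = (q u ^ 2 - h u ^ 2) + 2 * h y * h u - h y ^ 2 :=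
      fun u => by ring
    simp only [h2] at h1
    rw [intervalIntegral.integral_sub (hI (by fun_prop)) (hI (by fun_prop)),
      intervalIntegral.integral_add (hI (by fun_prop)) (hI (by fun_prop)), hB',
      intervalIntegral.integral_const_mul, hH', intervalIntegral.integral_const,
      smul_eq_mul, add_sub_cancel_left] at h1
    linarith
  have hmono : ∫ u in x..(x + Real.pi), Real.pi * (h u ^ 2 * ρ u) ≤
      ∫ u in x..(x + Real.pi), (2 * H * (h u * ρ u) - B * ρ u) := by
    refine intervalIntegral.integral_mono_on_of_le_Ioo (by linarith [Real.pi_pos])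
      (hI (by fun_prop)) (hI (by fun_prop)) fun u hu => ?_
    have := mul_le_mul_of_nonneg_right (hpt u hu) (hρ0 u).le
    linarith
  rw [intervalIntegral.integral_const_mul, intervalIntegral.integral_sub (hI (by fun_prop))
    (hI (by fun_prop)), intervalIntegral.integral_const_mul,
    intervalIntegral.integral_const_mul] at hmono
  linarith

/-! ### The area-bisecting chord and Gage's inequality. -/

namespace IsNormalParam

variable {a : ℝ → ℂ} {ρ : ℝ → ℝ} (ha : IsNormalParam a ρ)

include ha

/-- Some chord joining two points with opposite normals bisects the enclosed area. -/
theorem exists_bisecting_chord : ∃ x : ℝ,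
    ∫ θ in x..(x + Real.pi), support a ((a x + a (x + Real.pi)) / 2) θ * ρ θ =
      (1 / 2) * ∫ θ in (0 : ℝ)..(2 * Real.pi), support a 0 θ * ρ θ := by
  set D : ℝ → ℝ := fun x =>
    ∫ θ in x..(x + Real.pi), support a ((a x + a (x + Real.pi)) / 2) θ * ρ θ with hD
  have hρ := ha.continuous_radius
  have hs := fun o => ha.continuous_support o
  have hac := ha.continuous
  -- Here x enters both the limits and the origin; separating the origin into explicit endpoint
  -- terms makes continuity in x visible.
  have hDeq : ∀ x, D x = ((∫ θ in (0 : ℝ)..(x + Real.pi), support a 0 θ * ρ θ) -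
      ∫ θ in (0 : ℝ)..x, support a 0 θ * ρ θ) -
      ((a x + a (x + Real.pi)) / 2).re * ((a (x + Real.pi)).im - (a x).im) +
      ((a x + a (x + Real.pi)) / 2).im * ((a (x + Real.pi)).re - (a x).re) := by
    intro x
    have hfun : ∀ o θ, support a o θ * ρ θ = support a 0 θ * ρ θ - o.re * (ρ θ * Real.cos θ)
        + o.im * (-(ρ θ * Real.sin θ)) := fun o θ => by
      simp only [support, zero_re, zero_im]
      ring
    have hs0 := hs 0
    simp only [hD]
    simp only [hfun ((a x + a (x + Real.pi)) / 2)]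
    rw [intervalIntegral.integral_add ((by fun_prop : Continuous _).intervalIntegrable _ _)
        ((by fun_prop : Continuous _).intervalIntegrable _ _),
      intervalIntegral.integral_sub ((by fun_prop : Continuous _).intervalIntegrable _ _)
        ((by fun_prop : Continuous _).intervalIntegrable _ _),
      intervalIntegral.integral_const_mul, intervalIntegral.integral_const_mul,
      intervalIntegral.integral_eq_sub_of_hasDerivAt (fun θ _ => ha.hasDerivAt_im θ)
        ((by fun_prop : Continuous _).intervalIntegrable _ _),
      intervalIntegral.integral_eq_sub_of_hasDerivAt (fun θ _ => ha.hasDerivAt_re θ)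
        ((by fun_prop : Continuous _).intervalIntegrable _ _),
      intervalIntegral.integral_interval_sub_left
        ((by fun_prop : Continuous _).intervalIntegrable _ _)
        ((by fun_prop : Continuous _).intervalIntegrable _ _)]
  have hDc : Continuous D := by
    rw [funext hDeq]
    have hprim : Continuous fun x => ∫ θ in (0 : ℝ)..x, support a 0 θ * ρ θ :=
      intervalIntegral.continuous_primitive
        (fun _ _ => ((hs 0).mul hρ).intervalIntegrable _ _) 0
    have hprim' := hprim.comp (continuous_add_const Real.pi)
    exact ((hprim'.sub hprim).sub (by fun_prop)).add (by fun_prop)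
  have hI : ∀ o c d, IntervalIntegrable (fun θ => support a o θ * ρ θ) volume c d :=
    fun o _ _ => ((hs o).mul hρ).intervalIntegrable _ _
  -- The chords for 0 and π coincide, with the same midpoint and complementary half-periods, so half
  -- of the total lies between D 0 and D π.
  have hsum : D 0 + D Real.pi = ∫ θ in (0 : ℝ)..(2 * Real.pi), support a 0 θ * ρ θ := by
    have hper : a (Real.pi + Real.pi) = a 0 := by
      have := ha.periodic 0
      rwa [zero_add, two_mul] at this
    simp only [hD]
    rw [hper, zero_add, add_comm (a Real.pi) (a 0),
      intervalIntegral.integral_add_adjacent_intervals (hI _ _ _) (hI _ _ _),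
      ← two_mul, ← ha.integral_support_mul_radius ((a 0 + a Real.pi) / 2) 0, zero_add]
  have hmem : (1 / 2) * (∫ θ in (0 : ℝ)..(2 * Real.pi), support a 0 θ * ρ θ) ∈
      uIcc (D 0) (D Real.pi) := by
    rw [← hsum, mem_uIcc]
    rcases le_total (D 0) (D Real.pi) with h | h
    · left; constructor <;> linarith
    · right; constructor <;> linarith
  obtain ⟨x, -, hx⟩ := intermediate_value_uIcc hDc.continuousOn hmem
  exact ⟨x, hx⟩

/-- For a suitable origin, the second moment of the support function is at most `L A / π`. -/
theorem exists_integral_sq_mul_radius_le : ∃ o : ℂ,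
    Real.pi * ∫ θ in (0 : ℝ)..(2 * Real.pi), support a o θ ^ 2 * ρ θ ≤
      (∫ θ in (0 : ℝ)..(2 * Real.pi), ρ θ) *
        ((1 / 2) * ∫ θ in (0 : ℝ)..(2 * Real.pi), support a 0 θ * ρ θ) := by
  obtain ⟨x, hx⟩ := ha.exists_bisecting_chord
  set o := (a x + a (x + Real.pi)) / 2 with ho
  have hρ := ha.continuous_radius
  have hs := ha.continuous_support o
  have hI : ∀ {f : ℝ → ℝ} {c d : ℝ}, Continuous f → IntervalIntegrable f volume c d :=
    fun hf => hf.intervalIntegrable _ _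
  have hre : o.re = ((a x).re + (a (x + Real.pi)).re) / 2 := by simp [ho]
  have him : o.im = ((a x).im + (a (x + Real.pi)).im) / 2 := by simp [ho]
  -- Opposite normals at points symmetric about the midpoint o: both sign changes cancel, for h and
  -- for its derivative.
  have h1 : support a o (x + Real.pi) = support a o x := by
    simp only [support, Real.cos_add_pi, Real.sin_add_pi, hre, him]
    ring
  have h2 : supportDeriv a o (x + Real.pi) = supportDeriv a o x := by
    simp only [supportDeriv, Real.cos_add_pi, Real.sin_add_pi, hre, him]
    ring
  have e : x + Real.pi + Real.pi = x + 2 * Real.pi := by ring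
  have h3 : support a o (x + Real.pi + Real.pi) = support a o (x + Real.pi) := by
    rw [e, ha.support_periodic o x, h1]
  have h4 : supportDeriv a o (x + Real.pi + Real.pi) = supportDeriv a o (x + Real.pi) := by
    rw [e, ha.supportDeriv_periodic o x, h2]
  have k1 := integral_sq_mul_radius_le (ha.hasDerivAt_support o) (ha.hasDerivAt_supportDeriv o)
    hρ ha.radius_pos h1 h2
  have k2 := integral_sq_mul_radius_le (ha.hasDerivAt_support o) (ha.hasDerivAt_supportDeriv o)
    hρ ha.radius_pos h3 h4
  have hsplit : ∀ {f : ℝ → ℝ}, Continuous f → Function.Periodic f (2 * Real.pi) →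
      ∫ θ in (0 : ℝ)..(2 * Real.pi), f θ = (∫ θ in x..(x + Real.pi), f θ) +
        ∫ θ in (x + Real.pi)..(x + Real.pi + Real.pi), f θ := by
    intro f hf hp
    rw [intervalIntegral.integral_add_adjacent_intervals (hI hf) (hI hf), e,
      hp.intervalIntegral_add_eq x 0, zero_add]
  have hA := ha.integral_support_mul_radius o x
  have hsρ : Continuous fun θ => support a o θ * ρ θ := hs.mul hρ
  rw [← e, ← intervalIntegral.integral_add_adjacent_intervals (b := x + Real.pi)
    (hI hsρ) (hI hsρ)] at hA
  have hx2 : ∫ θ in (x + Real.pi)..(x + Real.pi + Real.pi), support a o θ * ρ θ =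
      (1 / 2) * ∫ θ in (0 : ℝ)..(2 * Real.pi), support a 0 θ * ρ θ := by linarith
  rw [hx] at k1
  rw [hx2] at k2
  refine ⟨o, ?_⟩
  rw [hsplit (by fun_prop) fun θ => by rw [ha.support_periodic o θ, ha.radius_periodic θ],
    hsplit hρ ha.radius_periodic, mul_add, add_mul]
  exact add_le_add k1 k2

/-- The difference ρ − h is the derivative of the periodic function h'. -/
theorem integral_support (o : ℂ) :
    ∫ θ in (0 : ℝ)..(2 * Real.pi), support a o θ = ∫ θ in (0 : ℝ)..(2 * Real.pi), ρ θ := by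
  have hρ := ha.continuous_radius
  have hs := ha.continuous_support o
  have h1 : ∫ θ in (0 : ℝ)..(2 * Real.pi), (ρ θ - support a o θ) = 0 := by
    have := ha.supportDeriv_periodic o 0
    rw [zero_add] at this
    rw [intervalIntegral.integral_eq_sub_of_hasDerivAt (fun u _ => ha.hasDerivAt_supportDeriv o u)
      ((by fun_prop : Continuous _).intervalIntegrable _ _), this, sub_self]
  rw [intervalIntegral.integral_sub (hρ.intervalIntegrable _ _) (hs.intervalIntegrable _ _)] at h1
  linarith

/-- **Gage's inequality**: `π L ≤ A ∫ k dθ`. -/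
theorem gage_inequality :
    Real.pi * ∫ θ in (0 : ℝ)..(2 * Real.pi), ρ θ ≤
      ((1 / 2) * ∫ θ in (0 : ℝ)..(2 * Real.pi), support a 0 θ * ρ θ) *
        ∫ θ in (0 : ℝ)..(2 * Real.pi), (ρ θ)⁻¹ := by
  obtain ⟨o, ho⟩ := ha.exists_integral_sq_mul_radius_le
  have hL := ha.integral_support o
  have hρ := ha.continuous_radius
  have hs := ha.continuous_support o
  have hinv : Continuous fun θ => (ρ θ)⁻¹ := hρ.inv₀ fun θ => (ha.radius_pos θ).ne'
  set A := (1 / 2) * ∫ θ in (0 : ℝ)..(2 * Real.pi), support a 0 θ * ρ θ with hA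
  set L := ∫ θ in (0 : ℝ)..(2 * Real.pi), ρ θ
  have hA0 : 0 < A := mul_pos (by norm_num) ha.integral_support_mul_radius_pos
  have hpi := Real.pi_pos
  have hmono : ∫ θ in (0 : ℝ)..(2 * Real.pi), 2 * (Real.pi / A) * support a o θ ≤
      ∫ θ in (0 : ℝ)..(2 * Real.pi),
        ((Real.pi / A) ^ 2 * (support a o θ ^ 2 * ρ θ) + (ρ θ)⁻¹) := by
    refine intervalIntegral.integral_mono_on Real.two_pi_pos.le
      ((by fun_prop : Continuous _).intervalIntegrable _ _)
      ((by fun_prop : Continuous _).intervalIntegrable _ _) fun θ _ => ?_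
    have h0 := ha.radius_pos θ
    -- The square vanishes for the circle centred at o, where hρ = A/π.
    have h1 : 0 ≤ (Real.pi / A * support a o θ * ρ θ - 1) ^ 2 * (ρ θ)⁻¹ := by positivity
    have h2 : (Real.pi / A * support a o θ * ρ θ - 1) ^ 2 * (ρ θ)⁻¹ =
        (Real.pi / A) ^ 2 * (support a o θ ^ 2 * ρ θ) + (ρ θ)⁻¹ -
          2 * (Real.pi / A) * support a o θ := by
      field_simp
      ring
    linarith
  rw [intervalIntegral.integral_add ((by fun_prop : Continuous _).intervalIntegrable _ _)
    ((by fun_prop : Continuous _).intervalIntegrable _ _), intervalIntegral.integral_const_mul,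
    intervalIntegral.integral_const_mul, hL] at hmono
  set M := ∫ θ in (0 : ℝ)..(2 * Real.pi), support a o θ ^ 2 * ρ θ
  set J := ∫ θ in (0 : ℝ)..(2 * Real.pi), (ρ θ)⁻¹
  have h1 : (Real.pi / A) ^ 2 * M ≤ Real.pi / A * L := by
    have h2 : (Real.pi / A) ^ 2 * M = Real.pi / A ^ 2 * (Real.pi * M) := by ring
    have h3 : Real.pi / A * L = Real.pi / A ^ 2 * (L * A) := by field_simp
    rw [h2, h3]
    exact mul_le_mul_of_nonneg_left ho (by positivity)
  have h2 : Real.pi / A * L ≤ J := by linarith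
  have h3 := mul_le_mul_of_nonneg_left h2 hA0.le
  have h4 : A * (Real.pi / A * L) = Real.pi * L := by field_simp
  linarith

end IsNormalParam

end PlaneCurve

/-! ### Calculus of the Steiner form of the entropy. -/

namespace PlaneCurve

/-- The entropy of the outer parallel at distance `r` of a curve with radius of curvature `ρ` and
enclosed area `A`, by Steiner's formula. -/
noncomputable def steinerEntropy (ρ : ℝ → ℝ) (A r : ℝ) : ℝ :=
  Real.pi * Real.log ((A + (∫ θ in (0 : ℝ)..(2 * Real.pi), ρ θ) * r + Real.pi * r ^ 2) / Real.pi) -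
    ∫ θ in (0 : ℝ)..(2 * Real.pi), Real.log (ρ θ + r)

section SteinerEntropy

variable {ρ : ℝ → ℝ} (hρ : Continuous ρ) (hρ0 : ∀ θ, 0 < ρ θ)

include hρ hρ0

theorem hasDerivAt_integral_log_add {r : ℝ} (hr : 0 ≤ r) :
    HasDerivAt (fun r => ∫ θ in (0 : ℝ)..(2 * Real.pi), Real.log (ρ θ + r))
      (∫ θ in (0 : ℝ)..(2 * Real.pi), (ρ θ + r)⁻¹) r := by
  -- With c the minimum of ρ, all x > r − c/2 satisfy ρ + x ≥ c/2. This gives a constant dominating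
  -- bound on a full neighbourhood of r, even at r = 0.
  obtain ⟨θ₀, -, hθ₀⟩ := (isCompact_Icc (a := (0 : ℝ)) (b := 2 * Real.pi)).exists_isMinOn
    (nonempty_Icc.2 Real.two_pi_pos.le) hρ.continuousOn
  set c := ρ θ₀ with hc
  have hc0 : 0 < c := hρ0 θ₀
  have hlow : ∀ θ ∈ uIoc (0 : ℝ) (2 * Real.pi), ∀ x ∈ Ioi (r - c / 2), c / 2 ≤ ρ θ + x := by
    intro θ hθ x hx
    rw [uIoc_of_le Real.two_pi_pos.le] at hθ
    have h1 : c ≤ ρ θ := hθ₀ (Ioc_subset_Icc_self hθ)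
    have h2 : r - c / 2 < x := hx
    linarith
  have hcont : ContinuousOn (fun θ => (ρ θ + r)⁻¹) univ :=
    ContinuousOn.inv₀ (by fun_prop) fun θ _ => by linarith [hρ0 θ]
  refine (intervalIntegral.hasDerivAt_integral_of_dominated_loc_of_deriv_le
    (F' := fun x θ => (ρ θ + x)⁻¹) (bound := fun _ => (c / 2)⁻¹)
    (Ioi_mem_nhds (by linarith : r - c / 2 < r)) (Eventually.of_forall fun x => ?_) ?_ ?_ ?_ ?_
    ?_).2
  · exact (Real.measurable_log.comp (hρ.measurable.add_const x)).aestronglyMeasurable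
  · exact (Continuous.log (by fun_prop) fun θ => by linarith [hρ0 θ]).intervalIntegrable _ _
  · exact (continuousOn_univ.1 hcont).aestronglyMeasurable
  · refine Eventually.of_forall fun θ hθ x hx => ?_
    have h := hlow θ hθ x hx
    rw [Real.norm_of_nonneg (inv_nonneg.2 (by linarith))]
    exact inv_anti₀ (by linarith) h
  · exact continuous_const.intervalIntegrable _ _
  · refine Eventually.of_forall fun θ hθ x hx => ?_
    have h := hlow θ hθ x hx
    have h1 : HasDerivAt (fun x => ρ θ + x) 1 x := (hasDerivAt_id x).const_add _
    simpa using h1.log (by linarith)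

theorem hasDerivAt_steinerEntropy {A r : ℝ} (hA : 0 < A) (hr : 0 ≤ r) :
    HasDerivAt (steinerEntropy ρ A)
      (Real.pi * ((∫ θ in (0 : ℝ)..(2 * Real.pi), ρ θ) + 2 * Real.pi * r) /
          (A + (∫ θ in (0 : ℝ)..(2 * Real.pi), ρ θ) * r + Real.pi * r ^ 2) -
        ∫ θ in (0 : ℝ)..(2 * Real.pi), (ρ θ + r)⁻¹) r := by
  have hL : 0 ≤ ∫ θ in (0 : ℝ)..(2 * Real.pi), ρ θ :=
    intervalIntegral.integral_nonneg Real.two_pi_pos.le fun θ _ => (hρ0 θ).le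
  refine HasDerivAt.sub ?_ (hasDerivAt_integral_log_add hρ hρ0 hr)
  set L := ∫ θ in (0 : ℝ)..(2 * Real.pi), ρ θ
  have hpi := Real.pi_pos
  have hpos : 0 < A + L * r + Real.pi * r ^ 2 := by positivity
  have h1 : HasDerivAt (fun r => (A + L * r + Real.pi * r ^ 2) / Real.pi)
      ((L * 1 + Real.pi * (2 * r)) / Real.pi) r := by
    have h2 : HasDerivAt (fun r : ℝ => r ^ 2) (2 * r) r := by simpa using hasDerivAt_pow 2 r
    exact ((((hasDerivAt_id r).const_mul L).const_add A).add (h2.const_mul Real.pi)).div_const _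
  convert! (h1.log (by positivity)).const_mul Real.pi using 1
  field_simp

theorem tendsto_steinerEntropy {A : ℝ} (hA : 0 < A) :
    Tendsto (steinerEntropy ρ A) atTop (𝓝 0) := by
  have hL : 0 ≤ ∫ θ in (0 : ℝ)..(2 * Real.pi), ρ θ :=
    intervalIntegral.integral_nonneg Real.two_pi_pos.le fun θ _ => (hρ0 θ).le
  have hpi := Real.pi_pos
  -- Integrates 0 ≤ log(1 + ρ/r) ≤ ρ/r.
  have hlog : ∀ r, 0 < r → 0 ≤ (∫ θ in (0 : ℝ)..(2 * Real.pi), Real.log (ρ θ + r)) -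
        2 * Real.pi * Real.log r ∧
      (∫ θ in (0 : ℝ)..(2 * Real.pi), Real.log (ρ θ + r)) - 2 * Real.pi * Real.log r ≤
        (∫ θ in (0 : ℝ)..(2 * Real.pi), ρ θ) / r := by
    intro r hr
    have hc : Continuous fun θ => Real.log (ρ θ + r) :=
      Continuous.log (by fun_prop) fun θ => by linarith [hρ0 θ]
    have heq : (∫ θ in (0 : ℝ)..(2 * Real.pi), Real.log (ρ θ + r)) - 2 * Real.pi * Real.log r =
        ∫ θ in (0 : ℝ)..(2 * Real.pi), (Real.log (ρ θ + r) - Real.log r) := by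
      rw [intervalIntegral.integral_sub (hc.intervalIntegrable _ _)
        (continuous_const.intervalIntegrable _ _), intervalIntegral.integral_const, sub_zero,
        smul_eq_mul]
    rw [heq]
    constructor
    · refine intervalIntegral.integral_nonneg Real.two_pi_pos.le fun θ _ => ?_
      exact sub_nonneg.2 (Real.log_le_log hr (by linarith [hρ0 θ]))
    · rw [← intervalIntegral.integral_div]
      refine intervalIntegral.integral_mono_on Real.two_pi_pos.le
        ((hc.sub continuous_const).intervalIntegrable _ _)
        ((hρ.div_const r).intervalIntegrable _ _) fun θ _ => ?_
      have h0 := hρ0 θ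
      rw [← Real.log_div (by positivity) hr.ne']
      refine (Real.log_le_sub_one_of_pos (by positivity)).trans (le_of_eq ?_)
      field_simp
      ring
  set L := ∫ θ in (0 : ℝ)..(2 * Real.pi), ρ θ with hLdef
  have hlim1 : Tendsto (fun r => (∫ θ in (0 : ℝ)..(2 * Real.pi), Real.log (ρ θ + r)) -
      2 * Real.pi * Real.log r) atTop (𝓝 0) := by
    refine tendsto_of_tendsto_of_tendsto_of_le_of_le' tendsto_const_nhds
      (tendsto_id.const_div_atTop L) ?_ ?_
    · filter_upwards [eventually_gt_atTop 0] with r hr using (hlog r hr).1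
    · filter_upwards [eventually_gt_atTop 0] with r hr using (hlog r hr).2
  have hlim2 : Tendsto (fun r : ℝ => Real.pi * Real.log (1 + L / Real.pi * r⁻¹ +
      A / Real.pi * r⁻¹ ^ 2)) atTop (𝓝 0) := by
    have hc : ContinuousAt (fun x : ℝ => Real.pi * Real.log (1 + L / Real.pi * x +
      A / Real.pi * x ^ 2)) 0 :=
      continuousAt_const.mul (ContinuousAt.log (by fun_prop) (by simp))
    have := hc.tendsto.comp tendsto_inv_atTop_zero
    simpa [Function.comp_def] using this
  have := hlim2.sub hlim1
  rw [sub_zero] at this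
  refine this.congr' ?_
  filter_upwards [eventually_gt_atTop 0] with r hr
  have h1 : (A + L * r + Real.pi * r ^ 2) / Real.pi =
      (1 + L / Real.pi * r⁻¹ + A / Real.pi * r⁻¹ ^ 2) * r ^ 2 := by
    field_simp
    ring
  rw [steinerEntropy, ← hLdef, h1, Real.log_mul (by positivity) (by positivity), Real.log_pow]
  push_cast
  ring

end SteinerEntropy

/-! ### Entropy along the outer parallels. -/

namespace IsStrictlyConvexClosedCurve

variable {α : ℝ → ℂ} (hα : IsStrictlyConvexClosedCurve α) {τ : ℝ → ℝ}
  (hN : ∀ θ : ℝ, outwardNormal α (τ θ) = exp (θ * I))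

include hα hN

omit hN in
theorem inv_curvature_outerParallel {r : ℝ} (hr : 0 ≤ r) (t : ℝ) :
    (curvature (PlaneCurve.outerParallel α r) t)⁻¹ = (curvature α t)⁻¹ + r := by
  have h := hα.curvature_pos t
  rw [hα.curvature_outerParallel hr, inv_div]
  field_simp

omit hα in
theorem support_outerParallel (r θ : ℝ) :
    support (fun θ => PlaneCurve.outerParallel α r (τ θ)) 0 θ =
      support (fun θ => α (τ θ)) 0 θ + r := by
  simp only [support, PlaneCurve.outerParallel, hN, add_re, add_im, re_ofReal_mul, im_ofReal_mul,
    exp_ofReal_mul_I_re, exp_ofReal_mul_I_im, zero_re, zero_im]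
  linear_combination r * Real.sin_sq_add_cos_sq θ

variable (hτ : ∀ θ, HasDerivAt τ (curvature α (τ θ) * ‖deriv α (τ θ)‖)⁻¹ θ)

include hτ

theorem isNormalParam_outerParallel {r : ℝ} (hr : 0 ≤ r) :
    IsNormalParam (fun θ => PlaneCurve.outerParallel α r (τ θ))
      (fun θ => (curvature α (τ θ))⁻¹ + r) := by
  have h := (hα.outerParallel hr).isNormalParam
    (fun θ => by rw [hα.outwardNormal_outerParallel hr, hN])
    (fun θ => by rw [hα.curvature_mul_speed_outerParallel hr]; exact hτ θ)
  simpa only [hα.inv_curvature_outerParallel hr] using h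

/-- **Steiner's formula** for the area enclosed by the outer parallels. -/
theorem enclosedArea_outerParallel {r : ℝ} (hr : 0 ≤ r) :
    enclosedArea (PlaneCurve.outerParallel α r) = enclosedArea α +
      (∫ θ in (0 : ℝ)..(2 * Real.pi), (curvature α (τ θ))⁻¹) * r + Real.pi * r ^ 2 := by
  have ha := hα.isNormalParam hN hτ
  have hr' := hα.isNormalParam_outerParallel hN hτ hr
  rw [ha.enclosedArea_eq (hα.range_comp_eq hN), hr'.enclosedArea_eq
    ((hα.outerParallel hr).range_comp_eq
      (fun θ => by rw [hα.outwardNormal_outerParallel hr, hN]))]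
  simp only [support_outerParallel hN]
  have hL := ha.integral_support 0
  have hρ := ha.continuous_radius
  have hs := ha.continuous_support 0
  set s := support (fun θ => α (τ θ)) 0
  have hfun : ∀ θ, (s θ + r) * ((curvature α (τ θ))⁻¹ + r) =
      s θ * (curvature α (τ θ))⁻¹ + r * s θ + r * (curvature α (τ θ))⁻¹ + r ^ 2 :=
    fun θ => by ring
  simp only [hfun]
  have hI : ∀ {f : ℝ → ℝ}, Continuous f → IntervalIntegrable f volume 0 (2 * Real.pi) :=
    fun hf => hf.intervalIntegrable _ _
  have c1 : Continuous fun θ => s θ * (curvature α (τ θ))⁻¹ := hs.mul hρ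
  have c2 : Continuous fun θ => r * s θ := continuous_const.mul hs
  have c3 : Continuous fun θ => r * (curvature α (τ θ))⁻¹ := continuous_const.mul hρ
  have c4 : Continuous fun θ => s θ * (curvature α (τ θ))⁻¹ + r * s θ := c1.add c2
  have c5 : Continuous fun θ => s θ * (curvature α (τ θ))⁻¹ + r * s θ +
      r * (curvature α (τ θ))⁻¹ := c4.add c3
  rw [intervalIntegral.integral_add (hI c5) (hI continuous_const),
    intervalIntegral.integral_add (hI c4) (hI c3),
    intervalIntegral.integral_add (hI c1) (hI c2), intervalIntegral.integral_const_mul,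
    intervalIntegral.integral_const_mul, intervalIntegral.integral_const, hL, smul_eq_mul]
  ring

omit hN hτ in
theorem enclosedArea_pos : 0 < enclosedArea α := by
  obtain ⟨τ, hN, hτ⟩ := hα.exists_inverse_normalAngle
  have ha := hα.isNormalParam hN hτ
  rw [ha.enclosedArea_eq (hα.range_comp_eq hN)]
  exact mul_pos (by norm_num) ha.integral_support_mul_radius_pos

omit hτ in
theorem entropyDensity_eq (θ : ℝ) :
    entropyDensity α θ =
      (1 / 2) * Real.log (enclosedArea α / Real.pi) - Real.log (curvature α (τ θ))⁻¹ := by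
  have h0 : 0 < enclosedArea α / Real.pi := div_pos hα.enclosedArea_pos Real.pi_pos
  rw [entropyDensity, hα.curvatureAtNormalAngle_eq (hN θ),
    Real.log_mul (hα.curvature_pos _).ne' (Real.sqrt_pos.2 h0).ne', Real.log_sqrt h0.le,
    Real.log_inv]
  ring

omit hN hτ in
theorem continuous_entropyDensity : Continuous (entropyDensity α) := by
  obtain ⟨τ, hN, hτ⟩ := hα.exists_inverse_normalAngle
  rw [funext (hα.entropyDensity_eq hN)]
  have ha := hα.isNormalParam hN hτ
  exact continuous_const.sub (ha.continuous_radius.log fun θ => (ha.radius_pos θ).ne')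

theorem entropy_outerParallel {r : ℝ} (hr : 0 ≤ r) :
    entropy (PlaneCurve.outerParallel α r) =
      steinerEntropy (fun θ => (curvature α (τ θ))⁻¹) (enclosedArea α) r := by
  have hr' := hα.isNormalParam_outerParallel hN hτ hr
  have hc := hr'.continuous_radius.log fun θ => (hr'.radius_pos θ).ne'
  rw [entropy, funext ((hα.outerParallel hr).entropyDensity_eq (τ := τ)
    (fun θ => by rw [hα.outwardNormal_outerParallel hr, hN]))]
  simp only [hα.inv_curvature_outerParallel hr]
  rw [intervalIntegral.integral_sub (continuous_const.intervalIntegrable _ _)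
    (hc.intervalIntegrable _ _), intervalIntegral.integral_const, sub_zero, smul_eq_mul,
    hα.enclosedArea_outerParallel hN hτ hr, steinerEntropy]
  ring

-- The entropy agrees with its Steiner form only for r ≥ 0, hence the derivative within `Ici 0`. The
-- sign of the derivative is Gage's inequality for the parallel curve itself, whose length is L +
-- 2πr.
omit hN hτ in
theorem exists_hasDerivWithinAt_entropy_outerParallel {r : ℝ} (hr : 0 ≤ r) :
    ∃ d : ℝ, d ≤ 0 ∧ HasDerivWithinAt
      (fun x : ℝ => entropy (PlaneCurve.outerParallel α x)) d (Ici 0) r := by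
  obtain ⟨τ, hN, hτ⟩ := hα.exists_inverse_normalAngle
  have ha := hα.isNormalParam hN hτ
  have hr' := hα.isNormalParam_outerParallel hN hτ hr
  refine ⟨_, ?_, (hasDerivAt_steinerEntropy ha.continuous_radius ha.radius_pos
    hα.enclosedArea_pos hr).hasDerivWithinAt.congr
    (fun x hx => hα.entropy_outerParallel hN hτ hx) (hα.entropy_outerParallel hN hτ hr)⟩
  have hg := hr'.gage_inequality
  have hA := hr'.enclosedArea_eq ((hα.outerParallel hr).range_comp_eq
    (fun θ => by rw [hα.outwardNormal_outerParallel hr, hN]))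
  have hApos := (hα.outerParallel hr).enclosedArea_pos
  rw [← hA, intervalIntegral.integral_add (ha.continuous_radius.intervalIntegrable _ _)
    (continuous_const.intervalIntegrable _ _), intervalIntegral.integral_const, sub_zero,
    smul_eq_mul] at hg
  rw [← hα.enclosedArea_outerParallel hN hτ hr, sub_nonpos, div_le_iff₀ hApos]
  linarith

omit hN hτ in
theorem antitoneOn_entropy_outerParallel :
    AntitoneOn (fun r : ℝ => entropy (PlaneCurve.outerParallel α r)) (Ici 0) := by
  refine antitoneOn_of_deriv_nonpos (convex_Ici 0) (fun r hr => ?_) (fun r hr => ?_)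
    (fun r hr => ?_)
  · obtain ⟨d, -, hd⟩ := hα.exists_hasDerivWithinAt_entropy_outerParallel hr
    exact hd.continuousWithinAt
  · obtain ⟨d, -, hd⟩ := hα.exists_hasDerivWithinAt_entropy_outerParallel (interior_subset hr)
    exact (hd.mono interior_subset).differentiableWithinAt
  · obtain ⟨d, hd0, hd⟩ := hα.exists_hasDerivWithinAt_entropy_outerParallel (interior_subset hr)
    rwa [(hd.hasDerivAt (mem_interior_iff_mem_nhds.1 hr)).deriv]

omit hN hτ in
theorem tendsto_entropy_outerParallel :
    Tendsto (fun r : ℝ => entropy (PlaneCurve.outerParallel α r)) atTop (𝓝 0) := by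
  obtain ⟨τ, hN, hτ⟩ := hα.exists_inverse_normalAngle
  have ha := hα.isNormalParam hN hτ
  refine (tendsto_steinerEntropy ha.continuous_radius ha.radius_pos hα.enclosedArea_pos).congr' ?_
  filter_upwards [eventually_ge_atTop 0] with r hr
  exact (hα.entropy_outerParallel hN hτ hr).symm

omit hN hτ in
theorem entropy_outerParallel_nonneg {r : ℝ} (hr : 0 ≤ r) :
    0 ≤ entropy (PlaneCurve.outerParallel α r) := by
  refine le_of_tendsto hα.tendsto_entropy_outerParallel ?_
  filter_upwards [eventually_ge_atTop r] with x hx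
  exact hα.antitoneOn_entropy_outerParallel hr (hr.trans hx) hx

end IsStrictlyConvexClosedCurve

end PlaneCurve

theorem mainTheorem6 (α : ℝ → ℂ) (hα : PlaneCurve.IsStrictlyConvexClosedCurve α) :
    -- the entropy is meaningful along the outer parallels: each of them is again a strictly convex
    -- curve, its outward normal takes every unit vector as value exactly once, its enclosed area is
    -- positive (and finite), and the integrand is integrable
    (∀ r : ℝ, 0 ≤ r →
      PlaneCurve.IsStrictlyConvexClosedCurve (PlaneCurve.outerParallel α r) ∧
      Set.BijOn (PlaneCurve.outwardNormal (PlaneCurve.outerParallel α r))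
        (Set.Ico 0 (2 * Real.pi)) (Metric.sphere (0 : ℂ) 1) ∧
      0 < PlaneCurve.enclosedArea (PlaneCurve.outerParallel α r) ∧
      IntervalIntegrable (PlaneCurve.entropyDensity (PlaneCurve.outerParallel α r))
        MeasureTheory.volume 0 (2 * Real.pi)) ∧
    -- the derivative in `r` exists and is nonpositive (one-sided at `r = 0`)
    (∀ r : ℝ, 0 ≤ r → ∃ d : ℝ, d ≤ 0 ∧
      HasDerivWithinAt (fun ρ : ℝ => PlaneCurve.entropy (PlaneCurve.outerParallel α ρ)) d
        (Set.Ici 0) r) ∧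
    AntitoneOn (fun r : ℝ => PlaneCurve.entropy (PlaneCurve.outerParallel α r)) (Set.Ici 0) ∧
    Filter.Tendsto (fun r : ℝ => PlaneCurve.entropy (PlaneCurve.outerParallel α r))
      Filter.atTop (nhds 0) ∧
    (∀ r : ℝ, 0 ≤ r → 0 ≤ PlaneCurve.entropy (PlaneCurve.outerParallel α r)) ∧
    0 ≤ PlaneCurve.entropy α := by
  refine ⟨fun r hr => ⟨hα.outerParallel hr, (hα.outerParallel hr).bijOn_outwardNormal,
    (hα.outerParallel hr).enclosedArea_pos,
    (hα.outerParallel hr).continuous_entropyDensity.intervalIntegrable _ _⟩,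
    fun r hr => hα.exists_hasDerivWithinAt_entropy_outerParallel hr,
    hα.antitoneOn_entropy_outerParallel, hα.tendsto_entropy_outerParallel,
    fun r hr => hα.entropy_outerParallel_nonneg hr, ?_⟩
  have h := hα.entropy_outerParallel_nonneg le_rfl
  have h0 : PlaneCurve.outerParallel α 0 = α := by
    funext t
    simp [PlaneCurve.outerParallel]
  rwa [h0] at h
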